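/- Let $\mathrm{E}=\{(0),\,(ij)\ (1\le i<j\le 5),\,(k)\ (1\le k\le 5)\}$ be the set of 16 weights of the half-spinor representation of $\mathrm{Spin}(10)$, and let $\hat{\mathrm{E}}=\mathrm{E}\times\mathbb Z$, with elements written $\alpha^r=(\alpha,r)$ and $\alpha=\alpha^0$. Order $\hat{\mathrm{E}}$ by directed paths in the graph with the following arrows, for all $r\in\mathbb Z$: $(0)^r\to(12)^r\to(13)^r$; $(13)^r\to(23)^r,(14)^r$; $(23)^r\to(24)^r$; $(14)^r\to(24)^r,(15)^r$; $(24)^r\to(34)^r,(25)^r$; $(15)^r\to(25)^r$; $(34)^r\to(5)^r,(35)^r$; $(25)^r\to(35)^r$; $(5)^r\to(4)^r$; $(35)^r\to(4)^r,(45)^r$; $(4)^r\to(3)^r$; $(45)^r\to(3)^r$; $(3)^r\to(2)^r\to(1)^r$; and $(45)^r\to(0)^{r+1}$, $(3)^r\to(12)^{r+1}$, $(2)^r\to(13)^{r+1}$, $(1)^r\to(23)^{r+1}$. Write $\lambda=\lambda^{(0)}$, $w_{ij}=\lambda^{(ij)}$, $p_k=\lambda^{(k)}$, and consider the ten quadrics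 defining pure spinors: $$\begin{aligned} \Gamma^1&=\lambda p_1+w_{25}w_{34}-w_{24}w_{35}+w_{23}w_{45}, & \Gamma^{1^*}&=-p_2w_{12}+p_3w_{13}-p_4w_{14}+p_5w_{15},\\ \Gamma^2&=-\lambda p_2-w_{15}w_{34}+w_{14}w_{35}-w_{13}w_{45}, & \Gamma^{2^*}&=-p_1w_{12}+p_3w_{23}-p_4w_{24}+p_5w_{25},\\ \Gamma^3&=\lambda p_3+w_{15}w_{24}-w_{14}w_{25}+w_{12}w_{45}, & \Gamma^{3^*}&=-p_1w_{13}+p_2w_{23}-p_4w_{34}+p_5w_{35},\\ \Gamma^4&=-\lambda p_4-w_{15}w_{23}+w_{13}w_{25}-w_{12}w_{35}, & \Gamma^{4^*}&=-p_1w_{14}+p_2w_{24}-p_3w_{34}+p_5w_{45},\\ \Gamma^5&=\lambda p_5+w_{14}w_{23}-w_{13}w_{24}+w_{12}w_{34}, & \Gamma^{5^*}&=-p_1w_{15}+p_2w_{25}-p_3w_{35}+p_4w_{45}. \end{aligned}$$ For $\hat\delta\le\hat\delta'$ in $\hat{\mathrm{E}}$ let $A_{\hat\delta}^{\hat\delta'}$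 be the quotient of the polynomial algebra $\mathbb C[\lambda^{\hat\alpha}:\hat\delta\le\hat\alpha\le\hat\delta']$ by the ideal generated by all coefficients of powers of $x$ in the ten Laurent polynomials obtained from the $\Gamma^{\mathbf s}$ by substituting $\lambda^\alpha(x)=\sum_{l:\ \hat\delta\le\alpha^l\le\hat\delta'}\lambda^{\alpha^l}x^l$ for $\lambda^\alpha$. It is graded by $\deg\lambda^{\hat\alpha}=1$. The product of the maximal torus of $\mathrm{Spin}(10)$ (the double cover of the diagonal torus of $\mathrm{GL}(5)$ on which $\det^{1/2}$ is defined) with $\mathbb C^\times$ acts on it by graded algebra automorphisms: $(z,q)$ multiplies $\lambda^{\alpha^r}$ by $q^re_\alpha(z)$, where $e_{(0)}=\det^{-1/2}$, $e_{(ij)}=\det^{-1/2}z_iz_j$, $e_{(k)}=\det^{1/2}z_k^{-1}$. Let $A_{\hat\delta}^{\hat\delta'}(z,q,t)=\sum_{n\ge0}a_n(z,q)t^n$, where $a_n$ is the character of the $n$-th graded component. Let $(\hat\delta_r)_{r\in\mathbb Z}$ be the sequence with $\hat\delta_{4m}=(15)^m$, $\hat\delta_{4m+1}=(5)^m$, $\hat\delta_{4m+2}=(0)^{m+1}$,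 $\hat\delta_{4m+3}=(1)^m$ for $m\in\mathbb Z$, and for $\hat\gamma\le\hat\delta_r$ put $B^r_{\hat\gamma}(t)=A_{\hat\gamma}^{\hat\delta_r}(1,1,t)\in\mathbb C[[t]]$. Then for all $r\in\mathbb Z$ and all $\hat\gamma\in\hat{\mathrm{E}}$ with $\hat\gamma\le\hat\delta_{r-1}$ and $\hat\gamma\le\hat\delta_{r-2}$ (which imply $\hat\gamma\le\hat\delta_r$), $$B^r_{\hat\gamma}(t)=\frac{1+t}{(1-t)^2}\,B^{r-1}_{\hat\gamma}(t)+\frac{t}{(1-t)^4}\,B^{r-2}_{\hat\gamma}(t).$$ Moreover $$B^0_{(0)}(t)=\frac1{(1-t)^5},\qquad B^1_{(0)}(t)=\frac{1+t}{(1-t)^7}.$$ -/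

import Mathlib

/-- The sixteen weights `(0)`, `(ij)` with `i < j`, and `(k)` of the half-spinor representation
of `Spin(10)`. The constructor `wij` is `(ij)`, and `pk` is `(k)`. -/
inductive SpinorWeight : Type
  | zero
  | w12 | w13 | w14 | w15 | w23 | w24 | w25 | w34 | w35 | w45
  | p1 | p2 | p3 | p4 | p5
  deriving DecidableEq

instance SpinorWeight.instFintype : Fintype SpinorWeight where
  elems := {.zero, .w12, .w13, .w14, .w15, .w23, .w24, .w25, .w34, .w35, .w45,
    .p1, .p2, .p3, .p4, .p5}
  complete x := by cases x <;> decide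

/-- The arrows of the Hasse diagram of the sixteen weights. -/
inductive FiniteArrow : SpinorWeight → SpinorWeight → Prop
  | zero_w12 : FiniteArrow .zero .w12
  | w12_w13 : FiniteArrow .w12 .w13
  | w13_w23 : FiniteArrow .w13 .w23
  | w13_w14 : FiniteArrow .w13 .w14
  | w23_w24 : FiniteArrow .w23 .w24
  | w14_w24 : FiniteArrow .w14 .w24
  | w14_w15 : FiniteArrow .w14 .w15
  | w24_w34 : FiniteArrow .w24 .w34
  | w24_w25 : FiniteArrow .w24 .w25
  | w15_w25 : FiniteArrow .w15 .w25
  | w34_p5 : FiniteArrow .w34 .p5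
  | w34_w35 : FiniteArrow .w34 .w35
  | w25_w35 : FiniteArrow .w25 .w35
  | p5_p4 : FiniteArrow .p5 .p4
  | w35_p4 : FiniteArrow .w35 .p4
  | w35_w45 : FiniteArrow .w35 .w45
  | p4_p3 : FiniteArrow .p4 .p3
  | w45_p3 : FiniteArrow .w45 .p3
  | p3_p2 : FiniteArrow .p3 .p2
  | p2_p1 : FiniteArrow .p2 .p1

/-- The pairs `(α, β)` for which the affine diagram has the arrows `α^r → β^{r+1}`. -/
inductive LoopArrow : SpinorWeight → SpinorWeight → Prop
  | w45_zero : LoopArrow .w45 .zero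
  | p3_w12 : LoopArrow .p3 .w12
  | p2_w13 : LoopArrow .p2 .w13
  | p1_w23 : LoopArrow .p1 .w23

/-- A vertex `α^r = (α, r)` of the affine diagram, `α` a spinor weight and `r` an integer. -/
@[ext]
structure AffVertex : Type where
  wt : SpinorWeight
  deg : ℤ

/-- The arrows of the affine diagram. -/
inductive AffArrow : AffVertex → AffVertex → Prop
  | level {α β : SpinorWeight} (h : FiniteArrow α β) (r : ℤ) : AffArrow ⟨α, r⟩ ⟨β, r⟩
  | loop {α β : SpinorWeight} (h : LoopArrow α β) (r : ℤ) : AffArrow ⟨α, r⟩ ⟨β, r + 1⟩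

/-- The height of a spinor weight: the length of a directed path to it from `(0)`. -/
def SpinorWeight.height : SpinorWeight → ℤ
  | .zero => 0
  | .w12 => 1
  | .w13 => 2
  | .w14 | .w23 => 3
  | .w15 | .w24 => 4
  | .w25 | .w34 => 5
  | .w35 | .p5 => 6
  | .w45 | .p4 => 7
  | .p3 => 8
  | .p2 => 9
  | .p1 => 10

/-- The height function on the affine diagram, used to see that there are no directed cycles. -/
def AffVertex.height (v : AffVertex) : ℤ := 8 * v.deg + v.wt.height

theorem AffArrow.height_eq {a b : AffVertex} (h : AffArrow a b) : b.height = a.height + 1 := by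
  cases h with
  | level h r => cases h <;> simp [AffVertex.height, SpinorWeight.height] <;> ring
  | loop h r => cases h <;> simp [AffVertex.height, SpinorWeight.height] <;> ring

theorem AffArrow.height_lt_of_path {a b : AffVertex} (h : Relation.ReflTransGen AffArrow a b) :
    a = b ∨ a.height < b.height := by
  induction h with
  | refl => exact Or.inl rfl
  | tail _ h ih =>
    right
    have := h.height_eq
    rcases ih with rfl | ih <;> omega

/-- `a ≤ b` when there is a directed path from `a` to `b` in the affine diagram. -/
instance AffVertex.instPartialOrder : PartialOrder AffVertex where
  le := Relation.ReflTransGen AffArrow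
  le_refl _ := Relation.ReflTransGen.refl
  le_trans _ _ _ := Relation.ReflTransGen.trans
  le_antisymm a b hab hba := by
    rcases AffArrow.height_lt_of_path hab with h | h
    · exact h
    · rcases AffArrow.height_lt_of_path hba with h' | h'
      · exact h'.symm
      · omega

theorem AffVertex.deg_le_of_le {a b : AffVertex} (h : a ≤ b) : a.deg ≤ b.deg := by
  change Relation.ReflTransGen AffArrow a b at h
  induction h with
  | refl => exact le_rfl
  | tail _ h ih => cases h <;> simp_all; omega

/-- Intervals of the affine diagram are finite. -/
instance AffVertex.finite_Icc (a b : AffVertex) : Finite (Set.Icc a b) := by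
  have : Finite (SpinorWeight × Set.Icc a.deg b.deg) := inferInstance
  refine Finite.of_injective
    (fun v : Set.Icc a b => ((v.1.wt,
      ⟨v.1.deg, AffVertex.deg_le_of_le v.2.1, AffVertex.deg_le_of_le v.2.2⟩) :
        SpinorWeight × Set.Icc a.deg b.deg)) ?_
  intro v w h
  simp only [Prod.mk.injEq] at h
  exact Subtype.ext (AffVertex.ext h.1 (Subtype.mk.inj h.2))

/-- The ten indices `1, …, 5, 1*, …, 5*` of a basis of the vector representation. -/
inductive VectorIndex : Type
  | v1 | v2 | v3 | v4 | v5
  | v1s | v2s | v3s | v4s | v5s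

open SpinorWeight in
/-- The ten quadrics `Γ^s` that define pure spinors `x = (x α)`, in any commutative ring. -/
def pureSpinorQuadric {R : Type*} [CommRing R] (x : SpinorWeight → R) : VectorIndex → R
  | .v1 => x zero * x p1 + x w25 * x w34 - x w24 * x w35 + x w23 * x w45
  | .v2 => -(x zero * x p2) - x w15 * x w34 + x w14 * x w35 - x w13 * x w45
  | .v3 => x zero * x p3 + x w15 * x w24 - x w14 * x w25 + x w12 * x w45
  | .v4 => -(x zero * x p4) - x w15 * x w23 + x w13 * x w25 - x w12 * x w35
  | .v5 => x zero * x p5 + x w14 * x w23 - x w13 * x w24 + x w12 * x w34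
  | .v1s => -(x p2 * x w12) + x p3 * x w13 - x p4 * x w14 + x p5 * x w15
  | .v2s => -(x p1 * x w12) + x p3 * x w23 - x p4 * x w24 + x p5 * x w25
  | .v3s => -(x p1 * x w13) + x p2 * x w23 - x p4 * x w34 + x p5 * x w35
  | .v4s => -(x p1 * x w14) + x p2 * x w24 - x p3 * x w34 + x p5 * x w45
  | .v5s => -(x p1 * x w15) + x p2 * x w25 - x p3 * x w35 + x p4 * x w45

/-- The polynomial algebra on the variables `λ^v`, `v` in the interval `[a, b]`. -/
abbrev IntervalPoly (a b : AffVertex) : Type := MvPolynomial (Set.Icc a b) ℂ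

open Classical in
/-- The generating function `λ^α(z) = ∑ λ^{α^l} z^l`, over all `l` with `α^l ∈ [a, b]`. (Such
an `l` lies between the degrees of `a` and `b`, by `AffVertex.deg_le_of_le`.) -/
noncomputable def spinorGen (a b : AffVertex) (α : SpinorWeight) :
    LaurentPolynomial (IntervalPoly a b) :=
  ∑ l ∈ Finset.Icc a.deg b.deg,
    if h : (⟨α, l⟩ : AffVertex) ∈ Set.Icc a b then
      LaurentPolynomial.C (MvPolynomial.X ⟨⟨α, l⟩, h⟩) * LaurentPolynomial.T l
    else 0

/-- The relation `Γ^{s^k}`: the coefficient of `z^k` in `Γ^s(λ(z))`. -/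
noncomputable def affRelation (a b : AffVertex) (s : VectorIndex) (k : ℤ) : IntervalPoly a b :=
  (pureSpinorQuadric (spinorGen a b) s).coeff k

/-- The ideal of relations of the algebra of a semi-infinite Richardson variety. -/
noncomputable def richardsonIdeal (a b : AffVertex) : Ideal (IntervalPoly a b) :=
  Ideal.span {f | ∃ (s : VectorIndex) (k : ℤ), f = affRelation a b s k}

/-- The algebra `A_a^b` of a semi-infinite Richardson variety. -/
abbrev RichardsonAlgebra (a b : AffVertex) : Type := IntervalPoly a b ⧸ richardsonIdeal a b

/-- The `n`-th graded component of `A_a^b`, all variables having degree one. -/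
noncomputable def richardsonComponent (a b : AffVertex) (n : ℕ) :
    Submodule ℂ (RichardsonAlgebra a b) :=
  (MvPolynomial.homogeneousSubmodule (Set.Icc a b) ℂ n).map
    (Ideal.Quotient.mkₐ ℂ (richardsonIdeal a b)).toLinearMap

/-- The maximal torus of `Spin(10)`: the two-sheeted cover of the diagonal torus of `GL(5)` on
which a square root `p.2` of the determinant of the diagonal matrix `p.1` is chosen. -/
def spinTorus : Subgroup ((Fin 5 → ℂˣ) × ℂˣ) where
  carrier := {p | p.2 ^ 2 = ∏ i, p.1 i}
  mul_mem' {p p'} hp hp' := by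
    simp only [Set.mem_ofPred_eq, Prod.snd_mul, Prod.fst_mul, Pi.mul_apply,
      Finset.prod_mul_distrib, mul_pow] at *
    rw [hp, hp']
  one_mem' := by simp
  inv_mem' {p} hp := by
    simp only [Set.mem_ofPred_eq, Prod.snd_inv, Prod.fst_inv, Pi.inv_apply,
      Finset.prod_inv_distrib, inv_pow] at *
    rw [hp]

/-- The value `e_α(z)` of the weight `α` at `z`: it is `det^{-1/2}` for `(0)`,
`det^{-1/2} z_i z_j` for `(ij)`, and `det^{1/2} z_k^{-1}` for `(k)`. -/
def spinorChar (z : spinTorus) : SpinorWeight → ℂˣ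
  | .zero => z.1.2⁻¹
  | .w12 => z.1.2⁻¹ * z.1.1 0 * z.1.1 1
  | .w13 => z.1.2⁻¹ * z.1.1 0 * z.1.1 2
  | .w14 => z.1.2⁻¹ * z.1.1 0 * z.1.1 3
  | .w15 => z.1.2⁻¹ * z.1.1 0 * z.1.1 4
  | .w23 => z.1.2⁻¹ * z.1.1 1 * z.1.1 2
  | .w24 => z.1.2⁻¹ * z.1.1 1 * z.1.1 3
  | .w25 => z.1.2⁻¹ * z.1.1 1 * z.1.1 4
  | .w34 => z.1.2⁻¹ * z.1.1 2 * z.1.1 3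
  | .w35 => z.1.2⁻¹ * z.1.1 2 * z.1.1 4
  | .w45 => z.1.2⁻¹ * z.1.1 3 * z.1.1 4
  | .p1 => z.1.2 * (z.1.1 0)⁻¹
  | .p2 => z.1.2 * (z.1.1 1)⁻¹
  | .p3 => z.1.2 * (z.1.1 2)⁻¹
  | .p4 => z.1.2 * (z.1.1 3)⁻¹
  | .p5 => z.1.2 * (z.1.1 4)⁻¹

/-- The weight `q^r e_α(z)` of the variable `λ^{α^r}`. -/
noncomputable def affChar (z : spinTorus) (q : ℂˣ) (v : AffVertex) : ℂ :=
  ((q ^ v.deg * spinorChar z v.wt : ℂˣ) : ℂ)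

/-- The action of `(z, q)` on polynomials: `λ^{α^r} ↦ q^r e_α(z) λ^{α^r}`. -/
noncomputable def torusPolyAction (a b : AffVertex) (z : spinTorus) (q : ℂˣ) :
    IntervalPoly a b →ₐ[ℂ] IntervalPoly a b :=
  MvPolynomial.aeval fun v => MvPolynomial.C (affChar z q v.1) * MvPolynomial.X v

/-- `f` is multiplied by `c` and its variable `z` by `q` under the action on coefficients. -/
def ScalesBy {a b : AffVertex} (z : spinTorus) (q : ℂˣ) (c : ℂˣ)
    (f : LaurentPolynomial (IntervalPoly a b)) : Prop :=
  ∀ k : ℤ, torusPolyAction a b z q (f.coeff k) =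
    MvPolynomial.C ((c * q ^ k : ℂˣ) : ℂ) * f.coeff k

theorem ScalesBy.mul {a b : AffVertex} {z : spinTorus} {q c d : ℂˣ}
    {f g : LaurentPolynomial (IntervalPoly a b)} (hf : ScalesBy z q c f) (hg : ScalesBy z q d g) :
    ScalesBy z q (c * d) (f * g) := by
  intro k
  rw [AddMonoidAlgebra.coeff_mul]
  simp only [Finsupp.sum, map_sum, Finset.mul_sum]
  refine Finset.sum_congr rfl fun i _ => Finset.sum_congr rfl fun j _ => ?_
  split_ifs with h
  · subst h
    rw [map_mul, hf i, hg j, zpow_add]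
    simp only [Units.val_mul, map_mul]
    ring
  · simp

theorem ScalesBy.add {a b : AffVertex} {z : spinTorus} {q c : ℂˣ}
    {f g : LaurentPolynomial (IntervalPoly a b)} (hf : ScalesBy z q c f) (hg : ScalesBy z q c g) :
    ScalesBy z q c (f + g) := by
  intro k
  simp only [AddMonoidAlgebra.coeff_add, Finsupp.add_apply, map_add, hf k, hg k, mul_add]

theorem ScalesBy.neg {a b : AffVertex} {z : spinTorus} {q c : ℂˣ}
    {f : LaurentPolynomial (IntervalPoly a b)} (hf : ScalesBy z q c f) :
    ScalesBy z q c (-f) := by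
  intro k
  simp only [AddMonoidAlgebra.coeff_neg, Finsupp.neg_apply, map_neg, hf k, mul_neg]

theorem ScalesBy.sub {a b : AffVertex} {z : spinTorus} {q c : ℂˣ}
    {f g : LaurentPolynomial (IntervalPoly a b)} (hf : ScalesBy z q c f) (hg : ScalesBy z q c g) :
    ScalesBy z q c (f - g) := by
  rw [sub_eq_add_neg]
  exact hf.add hg.neg

theorem ScalesBy.sum {a b : AffVertex} {z : spinTorus} {q c : ℂˣ} {ι : Type*} (s : Finset ι)
    {f : ι → LaurentPolynomial (IntervalPoly a b)} (hf : ∀ i ∈ s, ScalesBy z q c (f i)) :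
    ScalesBy z q c (∑ i ∈ s, f i) := by
  classical
  induction s using Finset.induction_on with
  | empty => intro k; simp
  | insert i s his ih =>
    rw [Finset.sum_insert his]
    exact (hf i (Finset.mem_insert_self i s)).add
      (ih fun j hj => hf j (Finset.mem_insert_of_mem hj))

theorem scalesBy_spinorGen (a b : AffVertex) (z : spinTorus) (q : ℂˣ) (α : SpinorWeight) :
    ScalesBy z q (spinorChar z α) (spinorGen a b α) := by
  refine ScalesBy.sum _ fun l _ => ?_
  split_ifs with h
  · intro k
    rw [← LaurentPolynomial.single_eq_C_mul_T, AddMonoidAlgebra.coeff_single,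
      Finsupp.single_apply]
    split_ifs with hk
    · subst hk
      simp [torusPolyAction, affChar, mul_comm]
    · simp
  · intro k; simp

/-- The weight of the quadric `Γ^s`. -/
def vectorChar (z : spinTorus) : VectorIndex → ℂˣ
  | .v1 => (z.1.1 0)⁻¹
  | .v2 => (z.1.1 1)⁻¹
  | .v3 => (z.1.1 2)⁻¹
  | .v4 => (z.1.1 3)⁻¹
  | .v5 => (z.1.1 4)⁻¹
  | .v1s => z.1.1 0
  | .v2s => z.1.1 1
  | .v3s => z.1.1 2
  | .v4s => z.1.1 3
  | .v5s => z.1.1 4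

theorem scalesBy_quadric (a b : AffVertex) (z : spinTorus) (q : ℂˣ) (s : VectorIndex) :
    ScalesBy z q (vectorChar z s) (pureSpinorQuadric (spinorGen a b) s) := by
  have key : ∀ α β : SpinorWeight, spinorChar z α * spinorChar z β = vectorChar z s →
      ScalesBy z q (vectorChar z s) (spinorGen a b α * spinorGen a b β) := by
    intro α β h
    rw [← h]
    exact (scalesBy_spinorGen a b z q α).mul (scalesBy_spinorGen a b z q β)
  have hz : (z.1.2 : ℂ) ^ 2 = z.1.1 0 * z.1.1 1 * z.1.1 2 * z.1.1 3 * z.1.1 4 := by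
    have := congrArg (fun u : ℂˣ => (u : ℂ)) z.2
    simpa [Fin.prod_univ_five] using this
  cases s
  case v1 | v3 | v5 =>
    refine ((ScalesBy.add (key _ _ ?_) (key _ _ ?_)).sub (key _ _ ?_)).add (key _ _ ?_) <;>
    · ext
      simp only [spinorChar, vectorChar, Units.val_mul, Units.val_inv_eq_inv_val]
      field_simp
      try rw [hz]
      try ring
  case v2 | v4 =>
    refine ((ScalesBy.sub (key _ _ ?_).neg (key _ _ ?_)).add (key _ _ ?_)).sub (key _ _ ?_) <;>
    · ext
      simp only [spinorChar, vectorChar, Units.val_mul, Units.val_inv_eq_inv_val]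
      field_simp
      try rw [hz]
      try ring
  case v1s | v2s | v3s | v4s =>
    refine ((ScalesBy.add (key _ _ ?_).neg (key _ _ ?_)).sub (key _ _ ?_)).add (key _ _ ?_) <;>
    · ext
      simp only [spinorChar, vectorChar, Units.val_mul, Units.val_inv_eq_inv_val]
      field_simp
  case v5s =>
    refine ((ScalesBy.add (key _ _ ?_).neg (key _ _ ?_)).sub (key _ _ ?_)).add (key _ _ ?_) <;>
    · ext
      simp only [spinorChar, vectorChar, Units.val_mul, Units.val_inv_eq_inv_val]
      field_simp

theorem richardsonIdeal_le_comap (a b : AffVertex) (z : spinTorus) (q : ℂˣ) :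
    richardsonIdeal a b ≤ (richardsonIdeal a b).comap (torusPolyAction a b z q) := by
  refine Ideal.span_le.2 ?_
  rintro f ⟨s, k, rfl⟩
  change torusPolyAction a b z q (affRelation a b s k) ∈ richardsonIdeal a b
  rw [affRelation, scalesBy_quadric a b z q s k]
  exact Ideal.mul_mem_left _ _ (Ideal.subset_span ⟨s, k, rfl⟩)

/-- The action of `(z, q)` on `A_a^b`. -/
noncomputable def torusAction (a b : AffVertex) (z : spinTorus) (q : ℂˣ) :
    RichardsonAlgebra a b →ₐ[ℂ] RichardsonAlgebra a b :=
  Ideal.quotientMapₐ (richardsonIdeal a b) (torusPolyAction a b z q)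
    (richardsonIdeal_le_comap a b z q)

theorem torusPolyAction_isHomogeneous (a b : AffVertex) (z : spinTorus) (q : ℂˣ) (n : ℕ)
    (f : IntervalPoly a b) (hf : f.IsHomogeneous n) :
    (torusPolyAction a b z q f).IsHomogeneous n := by
  have h := hf.aeval (fun v : Set.Icc a b =>
    (MvPolynomial.C (affChar z q v.1) * MvPolynomial.X v : IntervalPoly a b)) (n := 1)
    fun v => by
      simpa using (MvPolynomial.isHomogeneous_C _ (affChar z q v.1)).mul
        (MvPolynomial.isHomogeneous_X ℂ v)
  simpa [torusPolyAction] using h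

theorem torusAction_mem (a b : AffVertex) (z : spinTorus) (q : ℂˣ) (n : ℕ) :
    ∀ x ∈ richardsonComponent a b n,
      (torusAction a b z q).toLinearMap x ∈ richardsonComponent a b n := by
  rintro _ ⟨f, hf, rfl⟩
  exact ⟨torusPolyAction a b z q f, torusPolyAction_isHomogeneous a b z q n f hf, rfl⟩

/-- The Poincaré series `A_a^b(z, q, t)`: the coefficient of `t^n` is the character at `(z, q)`
of the `n`-th graded component, that is, the trace of `(z, q)` acting on it. -/
noncomputable def poincareSeries (a b : AffVertex) (z : spinTorus) (q : ℂˣ) : PowerSeries ℂ :=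
  PowerSeries.mk fun n =>
    LinearMap.trace ℂ (richardsonComponent a b n)
      ((torusAction a b z q).toLinearMap.restrict (torusAction_mem a b z q n))

/-- The sequence `J` of vertices `δ_r`: it is `(15)^m, (5)^m, (0)^{m+1}, (1)^m` for
`r = 4m, 4m + 1, 4m + 2, 4m + 3`. -/
def deltaSeq (r : ℤ) : AffVertex :=
  if r % 4 = 0 then ⟨.w15, r / 4⟩
  else if r % 4 = 1 then ⟨.p5, r / 4⟩
  else if r % 4 = 2 then ⟨.zero, r / 4 + 1⟩
  else ⟨.p1, r / 4⟩

/-- The series `B_c^r(t) = A_c^{δ_r}(1, 1, t)`. -/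
noncomputable def deltaSeries (c : AffVertex) (r : ℤ) : PowerSeries ℂ :=
  poincareSeries c (deltaSeq r) 1 1

/-! In suitable planar coordinates the affine diagram is a staircase-shaped strip in ℤ², and its
order is the product order (`AffVertex.le_iff`). Each possible relation Γ^{s^k} has exactly one
product of two incomparable variables, and every incomparable pair arises from exactly one (s, k).
The factors of any other monomial of Γ^{s^k} bound this pair from below and from above
(`eq_or_le_lead`). Since the two heights in a monomial have a fixed sum, the incomparable product is
the unique term with the least sum of squared heights; it serves as the leading term, smallest
weight first.

For this weight the relations behave like a Gröbner basis (`isConfluent_pairRelation`). Two leading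
monomials that share a variable are resolved by the sixteen linear syzygies of the pure spinor
quadrics, and disjoint ones by the Koszul syzygy. Hence the monomials supported on chains give a
basis of A, and at z = q = 1 its series counts multichains in an interval
(`deltaSeries_eq_multichainSeries`).

Multichains satisfy a planar recursion: splitting off the top corner gives a factor 1 - t, and
inclusion-exclusion treats the rest (`planarSeries_step`). On the boundary of the strip two of the
three resulting terms cancel. The vertices δ_r are corners lying alternately on the left and on the
right boundary; eliminating the points between consecutive corners gives the recurrence, and running
down to (0)^0 gives the initial values. -/

/-! ### Planar coordinates on the affine diagram -/

/-- The first planar coordinate of a spinor weight. -/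
def SpinorWeight.cx : SpinorWeight → ℤ
  | .zero => 0
  | .w12 => 1
  | .w13 | .w14 | .w15 => 2
  | .w23 | .w24 | .w25 => 3
  | .w34 | .w35 | .w45 => 4
  | .p5 | .p4 | .p3 => 5
  | .p2 => 6
  | .p1 => 7

/-- The second planar coordinate of a spinor weight. -/
def SpinorWeight.cy : SpinorWeight → ℤ
  | .zero | .w12 | .w13 | .w23 => 0
  | .w14 | .w24 | .w34 | .p5 => 1
  | .w15 | .w25 | .w35 | .p4 => 2
  | .w45 | .p3 | .p2 | .p1 => 3

theorem SpinorWeight.coord_bounds :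
    ∀ v : SpinorWeight, (0 ≤ v.cx ∧ v.cx ≤ 7) ∧ 0 ≤ v.cy ∧ v.cy ≤ 3 := by
  decide

/-- The first planar coordinate of a vertex of the affine diagram. -/
def AffVertex.x (v : AffVertex) : ℤ := v.wt.cx + 4 * v.deg

/-- The second planar coordinate of a vertex of the affine diagram. -/
def AffVertex.y (v : AffVertex) : ℤ := v.wt.cy + 4 * v.deg

theorem AffVertex.height_eq_x_add_y (v : AffVertex) : v.height = v.x + v.y := by
  obtain ⟨w, r⟩ := v
  cases w <;> simp only [height, x, y, SpinorWeight.height, SpinorWeight.cx, SpinorWeight.cy] <;>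
    ring

/-- The shape of the strip: each row has room for four points, and the left end moves by two at
every odd row, so rows 2j - 1 and 2j both start at 2j. -/
theorem AffVertex.x_bounds (v : AffVertex) :
    2 * ((v.y + 1) / 2) ≤ v.x ∧ v.x ≤ 2 * ((v.y + 1) / 2) + 3 := by
  obtain ⟨w, r⟩ := v
  cases w <;> simp only [x, y, SpinorWeight.cx, SpinorWeight.cy] <;> omega

theorem AffVertex.ext_coords {v w : AffVertex} (hx : v.x = w.x) (hy : v.y = w.y) : v = w := by
  have key : ∀ a b : SpinorWeight, ∀ d ∈ Finset.Icc (-1 : ℤ) 1,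
      a.cx = b.cx + 4 * d → a.cy = b.cy + 4 * d → a = b ∧ d = 0 := by decide +kernel
  have h1 := SpinorWeight.coord_bounds v.wt
  have h2 := SpinorWeight.coord_bounds w.wt
  simp only [x, y] at hx hy
  obtain ⟨h, h'⟩ := key v.wt w.wt (w.deg - v.deg) (by simp; omega) (by omega) (by omega)
  exact AffVertex.ext h (by omega)

/-- One step of a greedy path from `a` to `b`. Every arrow raises a single coordinate by one; when
only one arrow leaves `a`, the bounds of the strip on `b` ensure that it does not overshoot. -/
theorem AffVertex.exists_arrow {a b : AffVertex} (hx : a.x ≤ b.x) (hy : a.y ≤ b.y)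
    (hab : a ≠ b) : ∃ c, AffArrow a c ∧ c.x ≤ b.x ∧ c.y ≤ b.y := by
  have hb := b.x_bounds
  have hne : a.x ≠ b.x ∨ a.y ≠ b.y := by
    by_contra! h
    exact hab (ext_coords h.1 h.2)
  generalize b.x = bx at *
  generalize b.y = bz at *
  obtain ⟨w, r⟩ := a
  have one : ∀ c : AffVertex, AffArrow ⟨w, r⟩ c → (c.x ≤ bx ∧ c.y ≤ bz) →
    ∃ c, AffArrow ⟨w, r⟩ c ∧ c.x ≤ bx ∧ c.y ≤ bz := fun c h h' => ⟨c, h, h'⟩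
  have two : ∀ c d : AffVertex, AffArrow ⟨w, r⟩ c → AffArrow ⟨w, r⟩ d →
    ((c.x ≤ bx ∧ c.y ≤ bz) ∨ (d.x ≤ bx ∧ d.y ≤ bz)) →
    ∃ c, AffArrow ⟨w, r⟩ c ∧ c.x ≤ bx ∧ c.y ≤ bz := by
    rintro c d h h' (h1 | h1)
    exacts [⟨c, h, h1⟩, ⟨d, h', h1⟩]
  cases w <;> simp only [x, y, SpinorWeight.cx, SpinorWeight.cy] at hx hy hne
  case zero =>
    exact one _ (.level .zero_w12 r)
      (by simp only [x, y, SpinorWeight.cx, SpinorWeight.cy]; omega)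
  case w12 =>
    exact one _ (.level .w12_w13 r)
      (by simp only [x, y, SpinorWeight.cx, SpinorWeight.cy]; omega)
  case w13 =>
    exact two _ _ (.level .w13_w23 r) (.level .w13_w14 r)
      (by simp only [x, y, SpinorWeight.cx, SpinorWeight.cy]; omega)
  case w23 =>
    exact one _ (.level .w23_w24 r)
      (by simp only [x, y, SpinorWeight.cx, SpinorWeight.cy]; omega)
  case w14 =>
    exact two _ _ (.level .w14_w24 r) (.level .w14_w15 r)
      (by simp only [x, y, SpinorWeight.cx, SpinorWeight.cy]; omega)
  case w24 =>
    exact two _ _ (.level .w24_w34 r) (.level .w24_w25 r)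
      (by simp only [x, y, SpinorWeight.cx, SpinorWeight.cy]; omega)
  case w15 =>
    exact one _ (.level .w15_w25 r)
      (by simp only [x, y, SpinorWeight.cx, SpinorWeight.cy]; omega)
  case w34 =>
    exact two _ _ (.level .w34_p5 r) (.level .w34_w35 r)
      (by simp only [x, y, SpinorWeight.cx, SpinorWeight.cy]; omega)
  case w25 =>
    exact one _ (.level .w25_w35 r)
      (by simp only [x, y, SpinorWeight.cx, SpinorWeight.cy]; omega)
  case p5 =>
    exact one _ (.level .p5_p4 r)
      (by simp only [x, y, SpinorWeight.cx, SpinorWeight.cy]; omega)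
  case w35 =>
    exact two _ _ (.level .w35_p4 r) (.level .w35_w45 r)
      (by simp only [x, y, SpinorWeight.cx, SpinorWeight.cy]; omega)
  case p4 =>
    exact one _ (.level .p4_p3 r)
      (by simp only [x, y, SpinorWeight.cx, SpinorWeight.cy]; omega)
  case w45 =>
    exact two _ _ (.level .w45_p3 r) (.loop .w45_zero r)
      (by simp only [x, y, SpinorWeight.cx, SpinorWeight.cy]; omega)
  case p3 =>
    exact two _ _ (.level .p3_p2 r) (.loop .p3_w12 r)
      (by simp only [x, y, SpinorWeight.cx, SpinorWeight.cy]; omega)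
  case p2 =>
    exact two _ _ (.level .p2_p1 r) (.loop .p2_w13 r)
      (by simp only [x, y, SpinorWeight.cx, SpinorWeight.cy]; omega)
  case p1 =>
    exact one _ (.loop .p1_w23 r)
      (by simp only [x, y, SpinorWeight.cx, SpinorWeight.cy]; omega)

/-- In planar coordinates the order of the affine diagram is the product order. -/
theorem AffVertex.le_iff {a b : AffVertex} : a ≤ b ↔ a.x ≤ b.x ∧ a.y ≤ b.y := by
  constructor
  · intro h
    change Relation.ReflTransGen AffArrow a b at h
    induction h with
    | refl => exact ⟨le_rfl, le_rfl⟩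
    | tail _ h ih =>
      refine ⟨ih.1.trans ?_, ih.2.trans ?_⟩ <;> cases h with
      | level h r => cases h <;> simp [x, y, SpinorWeight.cx, SpinorWeight.cy]
      | loop h r => cases h <;> simp [x, y, SpinorWeight.cx, SpinorWeight.cy] <;> omega
  · rintro ⟨hx, hy⟩
    obtain ⟨n, hn⟩ : ∃ n : ℕ, b.height - a.height = n :=
      ⟨(b.height - a.height).toNat, by simp only [height_eq_x_add_y]; omega⟩
    induction n generalizing a with
    | zero =>
      simp only [height_eq_x_add_y] at hn
      exact (ext_coords (by omega) (by omega) : a = b).le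
    | succ n ih =>
      by_cases hab : a = b
      · exact hab.le
      obtain ⟨c, hc, hcx, hcy⟩ := exists_arrow hx hy hab
      have := hc.height_eq
      exact (Relation.ReflTransGen.single hc : a ≤ c).trans (ih hcx hcy (by push_cast at hn; omega))

/-! ### The quadrics and their linear syzygies in tabular form -/

instance VectorIndex.instDecidableEq : DecidableEq VectorIndex := fun a b => by
  cases a <;> cases b <;> first | exact isTrue rfl | exact isFalse (by intro h; cases h)

instance VectorIndex.instFintype : Fintype VectorIndex where
  elems := {.v1, .v2, .v3, .v4, .v5, .v1s, .v2s, .v3s, .v4s, .v5s}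
  complete x := by cases x <;> decide

/-- The sign of the `i`-th monomial of the quadric `Γ^s`. -/
def quadricSign : VectorIndex → Fin 4 → ℤ
  | .v1 => ![1, 1, -1, 1]
  | .v2 => ![-1, -1, 1, -1]
  | .v3 => ![1, 1, -1, 1]
  | .v4 => ![-1, -1, 1, -1]
  | .v5 => ![1, 1, -1, 1]
  | .v1s => ![-1, 1, -1, 1]
  | .v2s => ![-1, 1, -1, 1]
  | .v3s => ![-1, 1, -1, 1]
  | .v4s => ![-1, 1, -1, 1]
  | .v5s => ![-1, 1, -1, 1]

/-- The first factor of the `i`-th monomial of the quadric `Γ^s`. -/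
def quadricFst : VectorIndex → Fin 4 → SpinorWeight
  | .v1 => ![.zero, .w25, .w24, .w23]
  | .v2 => ![.zero, .w15, .w14, .w13]
  | .v3 => ![.zero, .w15, .w14, .w12]
  | .v4 => ![.zero, .w15, .w13, .w12]
  | .v5 => ![.zero, .w14, .w13, .w12]
  | .v1s => ![.p2, .p3, .p4, .p5]
  | .v2s => ![.p1, .p3, .p4, .p5]
  | .v3s => ![.p1, .p2, .p4, .p5]
  | .v4s => ![.p1, .p2, .p3, .p5]
  | .v5s => ![.p1, .p2, .p3, .p4]

/-- The second factor of the `i`-th monomial of the quadric `Γ^s`. -/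
def quadricSnd : VectorIndex → Fin 4 → SpinorWeight
  | .v1 => ![.p1, .w34, .w35, .w45]
  | .v2 => ![.p2, .w34, .w35, .w45]
  | .v3 => ![.p3, .w24, .w25, .w45]
  | .v4 => ![.p4, .w23, .w25, .w35]
  | .v5 => ![.p5, .w23, .w24, .w34]
  | .v1s => ![.w12, .w13, .w14, .w15]
  | .v2s => ![.w12, .w23, .w24, .w25]
  | .v3s => ![.w13, .w23, .w34, .w35]
  | .v4s => ![.w14, .w24, .w34, .w45]
  | .v5s => ![.w15, .w25, .w35, .w45]

/-- The sign of the `t`-th term of the linear syzygy with label `σ`. -/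
def syzygySign : SpinorWeight → Fin 5 → ℤ
  | .zero => ![1, -1, 1, -1, 1]
  | .w12 => ![1, 1, -1, 1, -1]
  | .w13 => ![1, -1, -1, 1, -1]
  | .w23 => ![1, 1, 1, -1, 1]
  | .w14 => ![1, 1, -1, 1, -1]
  | .w24 => ![1, -1, 1, -1, 1]
  | .w34 => ![1, 1, -1, 1, -1]
  | .p5 => ![1, 1, 1, 1, 1]
  | .w15 => ![1, -1, -1, 1, -1]
  | .w25 => ![1, 1, 1, -1, 1]
  | .w35 => ![1, -1, -1, 1, -1]
  | .p4 => ![1, 1, 1, -1, 1]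
  | .w45 => ![1, 1, 1, -1, 1]
  | .p3 => ![1, 1, -1, -1, 1]
  | .p2 => ![1, -1, -1, -1, 1]
  | .p1 => ![1, 1, 1, 1, -1]

/-- The linear factor of the `t`-th term of the linear syzygy with label `σ`. -/
def syzygyWeight : SpinorWeight → Fin 5 → SpinorWeight
  | .zero => ![.p1, .p2, .p3, .p4, .p5]
  | .w12 => ![.p2, .p1, .w45, .w35, .w34]
  | .w13 => ![.p3, .p1, .w45, .w25, .w24]
  | .w23 => ![.p3, .p2, .w45, .w15, .w14]
  | .w14 => ![.p4, .p1, .w35, .w25, .w23]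
  | .w24 => ![.p4, .p2, .w35, .w15, .w13]
  | .w34 => ![.p4, .p3, .w25, .w15, .w12]
  | .p5 => ![.w15, .w25, .w35, .w45, .zero]
  | .w15 => ![.p5, .p1, .w34, .w24, .w23]
  | .w25 => ![.p5, .p2, .w34, .w14, .w13]
  | .w35 => ![.p5, .p3, .w24, .w14, .w12]
  | .p4 => ![.w14, .w24, .w34, .w45, .zero]
  | .w45 => ![.p5, .p4, .w23, .w13, .w12]
  | .p3 => ![.w13, .w23, .w34, .w35, .zero]
  | .p2 => ![.w12, .w23, .w24, .w25, .zero]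
  | .p1 => ![.w12, .w13, .w14, .w15, .zero]

/-- The quadric in the `t`-th term of the linear syzygy with label `σ`. -/
def syzygyIndex : SpinorWeight → Fin 5 → VectorIndex
  | .zero => ![.v1s, .v2s, .v3s, .v4s, .v5s]
  | .w12 => ![.v1, .v2, .v3s, .v4s, .v5s]
  | .w13 => ![.v1, .v3, .v2s, .v4s, .v5s]
  | .w23 => ![.v2, .v3, .v1s, .v4s, .v5s]
  | .w14 => ![.v1, .v4, .v2s, .v3s, .v5s]
  | .w24 => ![.v2, .v4, .v1s, .v3s, .v5s]
  | .w34 => ![.v3, .v4, .v1s, .v2s, .v5s]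
  | .p5 => ![.v1, .v2, .v3, .v4, .v5s]
  | .w15 => ![.v1, .v5, .v2s, .v3s, .v4s]
  | .w25 => ![.v2, .v5, .v1s, .v3s, .v4s]
  | .w35 => ![.v3, .v5, .v1s, .v2s, .v4s]
  | .p4 => ![.v1, .v2, .v3, .v5, .v4s]
  | .w45 => ![.v4, .v5, .v1s, .v2s, .v3s]
  | .p3 => ![.v1, .v2, .v4, .v5, .v3s]
  | .p2 => ![.v1, .v3, .v4, .v5, .v2s]
  | .p1 => ![.v2, .v3, .v4, .v5, .v1s]

theorem pureSpinorQuadric_eq_sum {R : Type*} [CommRing R] (x : SpinorWeight → R)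
    (s : VectorIndex) :
    pureSpinorQuadric x s =
      ∑ i, (quadricSign s i : R) * (x (quadricFst s i) * x (quadricSnd s i)) := by
  cases s <;>
    simp [pureSpinorQuadric, quadricSign, quadricFst, quadricSnd, Fin.sum_univ_four,
      sub_eq_add_neg]

/-- The sixteen linear syzygies between the ten quadrics of pure spinors. -/
theorem sum_syzygy_eq_zero {R : Type*} [CommRing R] (x : SpinorWeight → R) (σ : SpinorWeight) :
    ∑ t, (syzygySign σ t : R) *
      (x (syzygyWeight σ t) * pureSpinorQuadric x (syzygyIndex σ t)) = 0 := by
  cases σ <;>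
    simp [pureSpinorQuadric, syzygySign, syzygyWeight, syzygyIndex, Fin.sum_univ_five] <;> ring

/-! ### The incomparable pair of each relation -/

/-- The position in `Γ^s` of the monomial that contributes the product of two incomparable
variables to the relation `Γ^{s^k}`. -/
def leadPosition (s : VectorIndex) (k : ℤ) : Fin 4 :=
  if k % 2 = 0 then
    match s with
    | .v1 | .v2 | .v3 | .v4 | .v5 => 1
    | _ => 3
  else 0

/-- The degree of the first of the two incomparable variables whose product occurs in
the relation `Γ^{s^k}`. -/
def leadDegree (s : VectorIndex) (k : ℤ) : ℤ :=
  if k % 2 = 0 then k / 2 else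
    match s with
    | .v1 | .v2 | .v3 | .v4 | .v5 => k / 2 + 1
    | _ => k / 2

/-- The first of the two incomparable vertices in the relation `Γ^{s^k}`. -/
def leadFst (s : VectorIndex) (k : ℤ) : AffVertex :=
  ⟨quadricFst s (leadPosition s k), leadDegree s k⟩

/-- The second of the two incomparable vertices in the relation `Γ^{s^k}`. -/
def leadSnd (s : VectorIndex) (k : ℤ) : AffVertex :=
  ⟨quadricSnd s (leadPosition s k), k - leadDegree s k⟩

/-- The quadric in which the product of the coordinates of weights `a` and `b` occurs (if there
is one). -/
def quadricOf (a b : SpinorWeight) : VectorIndex :=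
  -- The default `.v1` is a junk value for pairs whose product lies in no quadric; by
  -- `eq_lead_of_incomp` incomparable pairs never need it.
  (([.v1, .v2, .v3, .v4, .v5, .v1s, .v2s, .v3s, .v4s, .v5s] : List VectorIndex).find? fun s =>
    decide (∃ i, (quadricFst s i = a ∧ quadricSnd s i = b) ∨
      (quadricFst s i = b ∧ quadricSnd s i = a))).getD .v1

/-- Incomparability in the affine diagram. -/
def AffVertex.Incomp (a b : AffVertex) : Prop := ¬a ≤ b ∧ ¬b ≤ a

theorem AffVertex.Incomp.symm {a b : AffVertex} (h : a.Incomp b) : b.Incomp a := ⟨h.2, h.1⟩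

theorem AffVertex.incomp_iff {a b : AffVertex} :
    a.Incomp b ↔ (a.x < b.x ∧ b.y < a.y) ∨ (b.x < a.x ∧ a.y < b.y) := by
  simp only [Incomp, le_iff]
  omega

theorem quadricOf_comm (a b : SpinorWeight) : quadricOf a b = quadricOf b a := by
  revert a b
  decide +kernel

theorem leadPosition_shift (s : VectorIndex) (k r : ℤ) :
    leadPosition s (k + 2 * r) = leadPosition s k := by
  simp [leadPosition]

theorem leadDegree_shift (s : VectorIndex) (k r : ℤ) :
    leadDegree s (k + 2 * r) = leadDegree s k + r := by
  unfold leadDegree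
  cases s <;> simp only <;> split_ifs <;> omega

theorem quadricOf_lead (s : VectorIndex) (k : ℤ) :
    quadricOf (leadFst s k).wt (leadSnd s k).wt = s := by
  have key : ∀ s i, quadricOf (quadricFst s i) (quadricSnd s i) = s := by decide +kernel
  exact key s _

theorem leadFst_deg_add_leadSnd_deg (s : VectorIndex) (k : ℤ) :
    (leadFst s k).deg + (leadSnd s k).deg = k := by
  simp [leadFst, leadSnd]

theorem leadFst_incomp_leadSnd (s : VectorIndex) (k : ℤ) :
    (leadFst s k).Incomp (leadSnd s k) := by
  rw [AffVertex.incomp_iff]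
  obtain ⟨j, rfl | rfl⟩ : ∃ j, k = 2 * j ∨ k = 2 * j + 1 := ⟨k / 2, by omega⟩ <;>
  cases s <;>
  simp [leadFst, leadSnd, leadPosition, leadDegree, quadricFst, quadricSnd, AffVertex.x,
    AffVertex.y, SpinorWeight.cx, SpinorWeight.cy, Int.add_emod] <;> omega

/-- Incomparable vertices have degrees differing by at most one, and everything is invariant under a
common shift of degrees, so this is a finite check. With `quadricOf_lead` and
`leadFst_deg_add_leadSnd_deg` it matches unordered incomparable pairs with the indices (s, k). -/
theorem eq_lead_of_incomp {a b : AffVertex} (h : a.Incomp b) :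
    (a = leadFst (quadricOf a.wt b.wt) (a.deg + b.deg) ∧
      b = leadSnd (quadricOf a.wt b.wt) (a.deg + b.deg)) ∨
    (b = leadFst (quadricOf a.wt b.wt) (a.deg + b.deg) ∧
      a = leadSnd (quadricOf a.wt b.wt) (a.deg + b.deg)) := by
  have key : ∀ v w : SpinorWeight, ∀ d ∈ Finset.Icc (-1 : ℤ) 1,
      ((v.cx < w.cx + 4 * d ∧ w.cy + 4 * d < v.cy) ∨
        (w.cx + 4 * d < v.cx ∧ v.cy < w.cy + 4 * d)) →
      (v = quadricFst (quadricOf v w) (leadPosition (quadricOf v w) d) ∧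
        w = quadricSnd (quadricOf v w) (leadPosition (quadricOf v w) d) ∧
        0 = leadDegree (quadricOf v w) d) ∨
      (w = quadricFst (quadricOf v w) (leadPosition (quadricOf v w) d) ∧
        v = quadricSnd (quadricOf v w) (leadPosition (quadricOf v w) d) ∧
        d = leadDegree (quadricOf v w) d) := by decide +kernel
  rw [AffVertex.incomp_iff] at h
  obtain ⟨v, r⟩ := a
  obtain ⟨w, r'⟩ := b
  have hv := SpinorWeight.coord_bounds v
  have hw := SpinorWeight.coord_bounds w
  obtain ⟨d, rfl⟩ : ∃ d, r' = r + d := ⟨r' - r, by ring⟩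
  simp only [AffVertex.x, AffVertex.y] at h
  have hk : r + (r + d) = d + 2 * r := by ring
  simp only [leadFst, leadSnd, hk, leadPosition_shift, leadDegree_shift, AffVertex.mk.injEq]
  rcases key v w d (by simp; omega) (by omega) with ⟨h1, h2, h3⟩ | ⟨h1, h2, h3⟩
  · exact Or.inl ⟨⟨h1, by omega⟩, h2, by omega⟩
  · exact Or.inr ⟨⟨h1, by omega⟩, h2, by omega⟩

/-- The factors of every monomial of a relation other than the product of two incomparable
variables are a lower and an upper bound of these two variables. -/
theorem eq_or_le_lead (s : VectorIndex) (k : ℤ) (i : Fin 4) (l : ℤ) :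
    (i = leadPosition s k ∧ l = leadDegree s k) ∨
    ((⟨quadricFst s i, l⟩ : AffVertex) ≤ leadFst s k ∧
      (⟨quadricFst s i, l⟩ : AffVertex) ≤ leadSnd s k ∧
      leadFst s k ≤ ⟨quadricSnd s i, k - l⟩ ∧ leadSnd s k ≤ ⟨quadricSnd s i, k - l⟩) ∨
    ((⟨quadricSnd s i, k - l⟩ : AffVertex) ≤ leadFst s k ∧
      (⟨quadricSnd s i, k - l⟩ : AffVertex) ≤ leadSnd s k ∧
      leadFst s k ≤ ⟨quadricFst s i, l⟩ ∧ leadSnd s k ≤ ⟨quadricFst s i, l⟩) := by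
  -- Shifting degrees reduces `k` to its parity `e`; `m` is the offset from the leading degree. For
  -- |m| > 2 the bounds on the coordinates already separate the factors.
  have key : ∀ s i, ∀ e ∈ Finset.Icc (0 : ℤ) 1, ∀ m ∈ Finset.Icc (-2 : ℤ) 2,
      ∀ l ∈ [leadDegree s e + m],
      (i = leadPosition s e ∧ m = 0) ∨
      (((quadricFst s i).cx + 4 * l ≤ (leadFst s e).x ∧
        (quadricFst s i).cy + 4 * l ≤ (leadFst s e).y) ∧
      ((quadricFst s i).cx + 4 * l ≤ (leadSnd s e).x ∧
        (quadricFst s i).cy + 4 * l ≤ (leadSnd s e).y) ∧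
      ((leadFst s e).x ≤ (quadricSnd s i).cx + 4 * (e - l) ∧
        (leadFst s e).y ≤ (quadricSnd s i).cy + 4 * (e - l)) ∧
      ((leadSnd s e).x ≤ (quadricSnd s i).cx + 4 * (e - l) ∧
        (leadSnd s e).y ≤ (quadricSnd s i).cy + 4 * (e - l))) ∨
      (((quadricSnd s i).cx + 4 * (e - l) ≤ (leadFst s e).x ∧
        (quadricSnd s i).cy + 4 * (e - l) ≤ (leadFst s e).y) ∧
      ((quadricSnd s i).cx + 4 * (e - l) ≤ (leadSnd s e).x ∧
        (quadricSnd s i).cy + 4 * (e - l) ≤ (leadSnd s e).y) ∧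
      ((leadFst s e).x ≤ (quadricFst s i).cx + 4 * l ∧
        (leadFst s e).y ≤ (quadricFst s i).cy + 4 * l) ∧
      ((leadSnd s e).x ≤ (quadricFst s i).cx + 4 * l ∧
        (leadSnd s e).y ≤ (quadricFst s i).cy + 4 * l)) := by decide +kernel
  have hdeg : ∀ s, ∀ e ∈ Finset.Icc (0 : ℤ) 1, 2 * leadDegree s e - e ≤ 1 ∧
      -1 ≤ 2 * leadDegree s e - e := by decide
  obtain ⟨e, j, rfl, he⟩ : ∃ e j, k = e + 2 * j ∧ e ∈ Finset.Icc (0 : ℤ) 1 :=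
    ⟨k % 2, k / 2, by omega, by simp; omega⟩
  obtain ⟨m, rfl⟩ : ∃ m, l = leadDegree s e + m + j := ⟨l - leadDegree s e - j, by omega⟩
  have h1 := SpinorWeight.coord_bounds (quadricFst s i)
  have h2 := SpinorWeight.coord_bounds (quadricSnd s i)
  have h3 := SpinorWeight.coord_bounds (quadricFst s (leadPosition s e))
  have h4 := SpinorWeight.coord_bounds (quadricSnd s (leadPosition s e))
  have h5 := hdeg s e he
  have h6 := key s i e he m
  simp only [AffVertex.le_iff, leadFst, leadSnd, leadPosition_shift, leadDegree_shift,
    AffVertex.x, AffVertex.y, Finset.mem_Icc, List.mem_singleton, forall_eq] at h6 ⊢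
  omega

theorem height_add_height (s : VectorIndex) (k : ℤ) (i : Fin 4) (l : ℤ) :
    (⟨quadricFst s i, l⟩ : AffVertex).height + (⟨quadricSnd s i, k - l⟩ : AffVertex).height =
      (leadFst s k).height + (leadSnd s k).height := by
  have key : ∀ s i j, (quadricFst s i).height + (quadricSnd s i).height =
      (quadricFst s j).height + (quadricSnd s j).height := by decide +kernel
  have := key s i (leadPosition s k)
  simp only [AffVertex.height, leadFst, leadSnd]
  omega

/-- The difference of the two sides is 2(p - u)(q - u). -/
theorem Int.sq_add_sq_lt_of_add_eq {p q u v : ℤ} (h : u + v = p + q)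
    (h' : (u < p ∧ u < q) ∨ (v < p ∧ v < q)) : p ^ 2 + q ^ 2 < u ^ 2 + v ^ 2 := by
  obtain rfl : v = p + q - u := by omega
  have : 0 < (p - u) * (q - u) := by
    rcases h' with ⟨h1, h2⟩ | ⟨h1, h2⟩
    · exact mul_pos (by omega) (by omega)
    · exact mul_pos_of_neg_of_neg (by omega) (by omega)
  nlinarith

/-- Any other monomial has one factor below both members of the incomparable pair, strictly because
these are incomparable, and has the same total height. It is therefore more spread out. -/
theorem height_sq_lt (s : VectorIndex) (k : ℤ) (i : Fin 4) (l : ℤ)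
    (h : ¬(i = leadPosition s k ∧ l = leadDegree s k)) :
    (leadFst s k).height ^ 2 + (leadSnd s k).height ^ 2 <
      (⟨quadricFst s i, l⟩ : AffVertex).height ^ 2 +
        (⟨quadricSnd s i, k - l⟩ : AffVertex).height ^ 2 := by
  have h1 := height_add_height s k i l
  have h2 := (eq_or_le_lead s k i l).resolve_left h
  have h3 := AffVertex.incomp_iff.1 (leadFst_incomp_leadSnd s k)
  simp only [AffVertex.le_iff, AffVertex.height_eq_x_add_y] at *
  generalize leadFst s k = a at *
  generalize leadSnd s k = b at *
  generalize (⟨quadricFst s i, l⟩ : AffVertex) = u at *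
  generalize (⟨quadricSnd s i, k - l⟩ : AffVertex) = v at *
  exact Int.sq_add_sq_lt_of_add_eq h1 (by omega)

/-! ### Syzygies resolving overlapping incomparable pairs -/

/-- Incomparability of `v^0` and `w^d` in planar coordinates. -/
def SpinorWeight.IncompAt (v w : SpinorWeight) (d : ℤ) : Prop :=
  (v.cx < w.cx + 4 * d ∧ w.cy + 4 * d < v.cy) ∨ (w.cx + 4 * d < v.cx ∧ v.cy < w.cy + 4 * d)

instance SpinorWeight.decidableIncompAt (v w : SpinorWeight) (d : ℤ) :
    Decidable (v.IncompAt w d) := by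
  unfold IncompAt
  infer_instance

theorem AffVertex.Incomp.incompAt {a b : AffVertex} (h : a.Incomp b) :
    a.wt.IncompAt b.wt (b.deg - a.deg) ∧ b.deg - a.deg ∈ Finset.Icc (-1 : ℤ) 1 := by
  have ha := SpinorWeight.coord_bounds a.wt
  have hb := SpinorWeight.coord_bounds b.wt
  rw [incomp_iff] at h
  simp only [x, y, SpinorWeight.IncompAt, Finset.mem_Icc] at *
  omega

/-- Two overlapping incomparable pairs `v^0, w^d` and `v^0, w'^{d'}` come from two terms of a
syzygy, and the other terms of this syzygy in the same degree have larger sums of squares of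
heights. -/
theorem exists_syzygy_aux : ∀ v w : SpinorWeight, ∀ d ∈ Finset.Icc (-1 : ℤ) 1, v.IncompAt w d →
    ∀ w' : SpinorWeight, ∀ d' ∈ Finset.Icc (-1 : ℤ) 1, v.IncompAt w' d' →
    ¬(w = w' ∧ d = d') →
    ∃ σ t₁ t₂, syzygyWeight σ t₁ = w' ∧ syzygyWeight σ t₂ = w ∧ t₁ ≠ t₂ ∧
      syzygyIndex σ t₁ = quadricOf v w ∧ syzygyIndex σ t₂ = quadricOf v w' ∧
      ∀ t,
        ((leadFst (syzygyIndex σ t) (d + d')).height +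
          (leadSnd (syzygyIndex σ t) (d + d')).height + (syzygyWeight σ t).height =
          v.height + (w.height + 8 * d) + (w'.height + 8 * d')) ∧
        (3 * (syzygyWeight σ t).height -
          (v.height + (w.height + 8 * d) + (w'.height + 8 * d')) ≤ 36 ∧
        -36 ≤ 3 * (syzygyWeight σ t).height -
          (v.height + (w.height + 8 * d) + (w'.height + 8 * d')) ∧
        6 * (v.height ^ 2 + (w.height + 8 * d) ^ 2 + (w'.height + 8 * d') ^ 2) - 2 *
          (v.height + (w.height + 8 * d) + (w'.height + 8 * d')) ^ 2 < 144) ∧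
        ∀ m ∈ Finset.Icc (-1 : ℤ) 1, (t = t₁ ∧ m = d') ∨ (t = t₂ ∧ m = d) ∨
          v.height ^ 2 + (w.height + 8 * d) ^ 2 + (w'.height + 8 * d') ^ 2 <
            ((syzygyWeight σ t).height + 8 * m) ^ 2 +
              (leadFst (syzygyIndex σ t) (d + d' - m)).height ^ 2 +
              (leadSnd (syzygyIndex σ t) (d + d' - m)).height ^ 2 := by
  decide +kernel

theorem leadFst_height_shift (s : VectorIndex) (k r : ℤ) :
    (leadFst s (k + 2 * r)).height = (leadFst s k).height + 8 * r := by
  simp only [leadFst, leadPosition_shift, leadDegree_shift, AffVertex.height]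
  ring

theorem leadSnd_height_shift (s : VectorIndex) (k r : ℤ) :
    (leadSnd s (k + 2 * r)).height = (leadSnd s k).height + 8 * r := by
  simp only [leadSnd, leadPosition_shift, leadDegree_shift, AffVertex.height]
  ring

theorem lead_height_add (s : VectorIndex) (k k' : ℤ) :
    (leadFst s k).height + (leadSnd s k).height =
      (leadFst s k').height + (leadSnd s k').height + 8 * (k - k') := by
  have key : ∀ s i j, (quadricFst s i).height + (quadricSnd s i).height =
      (quadricFst s j).height + (quadricSnd s j).height := by decide +kernel
  have := key s (leadPosition s k) (leadPosition s k')
  simp only [AffVertex.height, leadFst, leadSnd]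
  linarith

/-- All terms of one coefficient of a syzygy have the same total height, so comparing sums of
squares is invariant under a common shift. This moves `a` to degree zero, where a finite table
decides the nearby terms and convexity the remote ones. -/
theorem exists_syzygy {a b c : AffVertex} (hb : a.Incomp b) (hc : a.Incomp c) (hbc : b ≠ c) :
    ∃ σ t₁ t₂, syzygyWeight σ t₁ = c.wt ∧ syzygyWeight σ t₂ = b.wt ∧ t₁ ≠ t₂ ∧
      syzygyIndex σ t₁ = quadricOf a.wt b.wt ∧ syzygyIndex σ t₂ = quadricOf a.wt c.wt ∧
      ∀ t l, (t = t₁ ∧ l = c.deg) ∨ (t = t₂ ∧ l = b.deg) ∨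
        a.height ^ 2 + b.height ^ 2 + c.height ^ 2 <
          (⟨syzygyWeight σ t, l⟩ : AffVertex).height ^ 2 +
            (leadFst (syzygyIndex σ t) (a.deg + b.deg + c.deg - l)).height ^ 2 +
            (leadSnd (syzygyIndex σ t) (a.deg + b.deg + c.deg - l)).height ^ 2 := by
  obtain ⟨v, r⟩ := a
  obtain ⟨w, e⟩ := b
  obtain ⟨w', e'⟩ := c
  obtain ⟨d, rfl⟩ : ∃ d, e = r + d := ⟨e - r, by ring⟩
  obtain ⟨d', rfl⟩ : ∃ d', e' = r + d' := ⟨e' - r, by ring⟩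
  have hb' := hb.incompAt
  have hc' := hc.incompAt
  simp only [add_sub_cancel_left] at hb' hc'
  obtain ⟨σ, t₁, t₂, h1, h2, h3, h4, h5, h6⟩ :=
    exists_syzygy_aux v w d hb'.2 hb'.1 w' d' hc'.2 hc'.1 (by rintro ⟨rfl, rfl⟩; exact hbc rfl)
  refine ⟨σ, t₁, t₂, h1, h2, h3, h4, h5, fun t l => ?_⟩
  obtain ⟨m, rfl⟩ : ∃ m, l = r + m := ⟨l - r, by ring⟩
  obtain ⟨h7, h8, h9⟩ := h6 t
  have hk : r + (r + d) + (r + d') - (r + m) = d + d' - m + 2 * r := by ring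
  have hadd := lead_height_add (syzygyIndex σ t) (d + d' - m) (d + d')
  have hh : ∀ (w : SpinorWeight) (e : ℤ), (⟨w, e⟩ : AffVertex).height = w.height + 8 * e := by
    intro w e
    simp only [AffVertex.height]
    ring
  replace h9 := h9 m
  simp only [hk, leadFst_height_shift, leadSnd_height_shift]
  generalize (leadFst (syzygyIndex σ t) (d + d' - m)).height = A at *
  generalize (leadSnd (syzygyIndex σ t) (d + d' - m)).height = B at *
  simp only [hh, add_right_inj]
  have hsum : A + B + ((syzygyWeight σ t).height + 8 * m) =
      v.height + (w.height + 8 * d) + (w'.height + 8 * d') := by linarith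
  suffices h : (t = t₁ ∧ m = d') ∨ (t = t₂ ∧ m = d) ∨
      v.height ^ 2 + (w.height + 8 * d) ^ 2 + (w'.height + 8 * d') ^ 2 <
        ((syzygyWeight σ t).height + 8 * m) ^ 2 + A ^ 2 + B ^ 2 by
    rcases h with h | h | h
    · exact Or.inl h
    · exact Or.inr (Or.inl h)
    · refine Or.inr (Or.inr ?_)
      -- All three heights grow by 8r, so the squares acquire the cross term 16r times the total
      -- height, equal on both sides.
      have : 16 * r * (A + B + ((syzygyWeight σ t).height + 8 * m)) =
        16 * r * (v.height + (w.height + 8 * d) + (w'.height + 8 * d')) := by rw [hsum]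
      linarith
  -- For |m| ≥ 2 let S be the total height and h that of the linear factor. Since A² + B² ≥ (S -
  -- h)²/2, six times the sum of squares minus 2S² is at least (3h - S)². The table gives |3(h - 8m)
  -- - S| ≤ 36, so |3h - S| ≥ 48 - 36 = 12, and its bound 144 on the other side suffices.
  by_cases hm : m ∈ Finset.Icc (-1 : ℤ) 1
  · exact h9 hm
  · refine Or.inr (Or.inr ?_)
    generalize v.height = p, w.height + 8 * d = q, w'.height + 8 * d' = q' at *
    generalize (syzygyWeight σ t).height = u at *
    have hm' : m ≤ -2 ∨ 2 ≤ m := by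
      simp only [Finset.mem_Icc] at hm
      omega
    have h10 : 144 ≤ (3 * (u + 8 * m) - (p + q + q')) ^ 2 := by
      rcases hm' with hm' | hm' <;> nlinarith
    have h11 : 0 ≤ (A - B) ^ 2 := sq_nonneg _
    have h12 : A + B = p + q + q' - (u + 8 * m) := by linarith
    have h13 : 2 * (A ^ 2 + B ^ 2) = (p + q + q' - (u + 8 * m)) ^ 2 + (A - B) ^ 2 := by
      rw [← h12]; ring
    nlinarith

/-! ### Standard monomials for a confluent family of quadrics -/

section WeightedGroebner

open MvPolynomial

variable {σ K : Type*} [Field K]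

/-- The span of the monomials of degree `n` and weight at least `N`. -/
noncomputable def upperSpan (K : Type*) [Field K] (w : σ → ℕ) (n N : ℕ) :
    Submodule K (MvPolynomial σ K) :=
  Submodule.span K {p | ∃ u : σ →₀ ℕ, u.degree = n ∧ N ≤ Finsupp.weight w u ∧ p = monomial u 1}

/-- The span of the monomial multiples of degree `n` of the quadrics `g a b`, for related `a`
and `b`, whose leading monomials have weight at least `N`. -/
noncomputable def relationSpan (r : σ → σ → Prop) (g : σ → σ → MvPolynomial σ K) (w : σ → ℕ)
    (n N : ℕ) :
    Submodule K (MvPolynomial σ K) :=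
  Submodule.span K {p | ∃ (u : σ →₀ ℕ) (a b : σ), r a b ∧ u.degree + 2 = n ∧
    N ≤ Finsupp.weight w u + w a + w b ∧ p = monomial u 1 * g a b}

/-- The quadrics `g a b`, for related `a` and `b`, have leading monomials `X a * X b` with respect
to the weight `w`, and their overlaps are resolvable. -/
structure IsConfluent (r : σ → σ → Prop) (g : σ → σ → MvPolynomial σ K) (w : σ → ℕ) : Prop where
  symm : ∀ a b, r a b → r b a
  irrefl : ∀ a, ¬r a a
  comm : ∀ a b, g a b = g b a
  lead : ∀ a b, r a b →
    ∃ c : K, c ≠ 0 ∧ g a b - C c * (X a * X b) ∈ upperSpan K w 2 (w a + w b + 1)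
  overlap : ∀ a b c, r a b → r a c → b ≠ c →
    X c * g a b ∈ Submodule.span K {X b * g a c} ⊔ relationSpan r g w 3 (w a + w b + w c + 1)

theorem upperSpan_anti (w : σ → ℕ) (n : ℕ) {N N' : ℕ} (h : N ≤ N') :
    upperSpan K w n N' ≤ upperSpan K w n N :=
  Submodule.span_mono fun _ ⟨u, h1, h2, h3⟩ => ⟨u, h1, h.trans h2, h3⟩

theorem relationSpan_anti (r : σ → σ → Prop) (g : σ → σ → MvPolynomial σ K) (w : σ → ℕ) (n : ℕ)
    {N N' : ℕ} (h : N ≤ N') : relationSpan r g w n N' ≤ relationSpan r g w n N :=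
  Submodule.span_mono fun _ ⟨u, a, b, h1, h2, h3, h4⟩ => ⟨u, a, b, h1, h2, h.trans h3, h4⟩

theorem monomial_mem_upperSpan (w : σ → ℕ) (u : σ →₀ ℕ) :
    monomial u (1 : K) ∈ upperSpan K w u.degree (Finsupp.weight w u) :=
  Submodule.subset_span ⟨u, rfl, le_rfl, rfl⟩

theorem X_mul_X_mem_upperSpan (w : σ → ℕ) (a b : σ) :
    (X a * X b : MvPolynomial σ K) ∈ upperSpan K w 2 (w a + w b) := by
  refine Submodule.subset_span ⟨Finsupp.single a 1 + Finsupp.single b 1, ?_, ?_, ?_⟩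
  · simp
  · simp [Finsupp.weight_single]
  · simp [X, monomial_mul]

theorem mul_mem_upperSpan {w : σ → ℕ} {n N n' N' : ℕ} {p q : MvPolynomial σ K}
    (hp : p ∈ upperSpan K w n N) (hq : q ∈ upperSpan K w n' N') :
    p * q ∈ upperSpan K w (n + n') (N + N') := by
  have h := Submodule.mul_mem_mul hp hq
  rw [upperSpan, upperSpan, Submodule.span_mul_span] at h
  refine Submodule.span_mono ?_ h
  rintro _ ⟨_, ⟨u, h1, h2, rfl⟩, _, ⟨v, h3, h4, rfl⟩, rfl⟩
  exact ⟨u + v, by simp [h1, h3], by simpa using add_le_add h2 h4, by simp [monomial_mul]⟩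

theorem mul_mem_relationSpan {r : σ → σ → Prop} {g : σ → σ → MvPolynomial σ K} {w : σ → ℕ}
    {n N n' N' : ℕ} {p q : MvPolynomial σ K}
    (hp : p ∈ upperSpan K w n N) (hq : q ∈ relationSpan r g w n' N') :
    p * q ∈ relationSpan r g w (n + n') (N + N') := by
  have h := Submodule.mul_mem_mul hp hq
  rw [upperSpan, relationSpan, Submodule.span_mul_span] at h
  refine Submodule.span_mono ?_ h
  rintro _ ⟨_, ⟨u, h1, h2, rfl⟩, _, ⟨v, a, b, h3, h4, h5, rfl⟩, rfl⟩
  refine ⟨u + v, a, b, h3, by simp [h1]; omega, by simp; omega, ?_⟩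
  simp only [← mul_assoc, monomial_mul, mul_one]

theorem mem_relationSpan_two {r : σ → σ → Prop} (g : σ → σ → MvPolynomial σ K) (w : σ → ℕ)
    {a b : σ} (h : r a b) : g a b ∈ relationSpan r g w 2 (w a + w b) :=
  Submodule.subset_span ⟨0, a, b, h, by simp, by simp, by simp⟩

namespace IsConfluent

variable {r : σ → σ → Prop} {g : σ → σ → MvPolynomial σ K} {w : σ → ℕ}

theorem quadric_mem_upperSpan (hg : IsConfluent r g w) {a b : σ} (h : r a b) :
    g a b ∈ upperSpan K w 2 (w a + w b) := by
  obtain ⟨c, -, hc⟩ := hg.lead a b h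
  have h1 := Submodule.smul_mem _ c (X_mul_X_mem_upperSpan (K := K) w a b)
  rw [smul_eq_C_mul] at h1
  simpa using add_mem (upperSpan_anti w 2 (Nat.le_succ _) hc) h1

/-- If `b ≠ b'`, comparing exponents shows that `X b'` divides the multiplier of `g a b`. The claim
is then a monomial multiple of the cubic condition `overlap`. -/
theorem resolve_of_left_eq (hg : IsConfluent r g w) {a b b' : σ} {u u' : σ →₀ ℕ}
    (h : r a b) (h' : r a b') (hu : u + Finsupp.single b 1 = u' + Finsupp.single b' 1) :
    monomial u 1 * g a b ∈ Submodule.span K {monomial u' 1 * g a b'} ⊔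
      relationSpan r g w (u.degree + 2) (Finsupp.weight w u + w a + w b + 1) := by
  by_cases hb : b = b'
  · subst hb
    rw [add_right_cancel hu]
    exact Submodule.mem_sup_left (Submodule.mem_span_singleton_self _)
  · have hle : Finsupp.single b' 1 ≤ u := by
      intro x
      have := DFunLike.congr_fun hu x
      classical
      simp only [Finsupp.add_apply, Finsupp.single_apply] at this ⊢
      split_ifs at * <;> first | omega | (subst_vars; exact absurd rfl hb)
    obtain ⟨v, rfl⟩ := exists_add_of_le hle
    obtain rfl : u' = v + Finsupp.single b 1 := by
      apply add_right_cancel (b := Finsupp.single b' 1)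
      rw [← hu]
      abel
    have h1 := hg.overlap a b b' h h' hb
    obtain ⟨p, hp, q, hq, hpq⟩ := Submodule.mem_sup.1 h1
    obtain ⟨c, rfl⟩ := Submodule.mem_span_singleton.1 hp
    have h2 : monomial (Finsupp.single b' 1 + v) (1 : K) * g a b =
        c • (monomial (v + Finsupp.single b 1) 1 * g a b') + monomial v 1 * q := by
      have e : ∀ x : σ, monomial (Finsupp.single x 1 + v) (1 : K) = monomial v 1 * X x := by
        intro x
        rw [X, monomial_mul, add_comm, one_mul]
      rw [add_comm v, e, e, mul_assoc, ← hpq, mul_add, mul_smul_comm, mul_assoc]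
    rw [h2]
    refine Submodule.add_mem_sup
      (Submodule.smul_mem _ _ (Submodule.mem_span_singleton_self _)) ?_
    have h3 := mul_mem_relationSpan (monomial_mem_upperSpan (K := K) w v) hq
    convert h3 using 1
    simp [Finsupp.weight_single]
    congr 1 <;> ring

/-- The Koszul syzygy: the product of the two quadrics can be expanded along the leading term of
either, and the tails contribute only terms of higher weight. Hence `IsConfluent` needs no condition
for disjoint pairs. -/
theorem resolve_of_disjoint (hg : IsConfluent r g w) {a b a' b' : σ} (v : σ →₀ ℕ)
    (h : r a b) (h' : r a' b') :
    monomial v 1 * (X a' * X b') * g a b ∈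
      Submodule.span K {monomial v 1 * (X a * X b) * g a' b'} ⊔
      relationSpan r g w (v.degree + 2 + 2)
        (Finsupp.weight w v + (w a' + w b') + (w a + w b) + 1) := by
  obtain ⟨c, hc, ht⟩ := hg.lead a b h
  obtain ⟨c', hc', ht'⟩ := hg.lead a' b' h'
  set t := g a b - C c * (X a * X b) with hdt
  set t' := g a' b' - C c' * (X a' * X b') with hdt'
  have key : monomial v 1 * (X a' * X b') * g a b =
      (c'⁻¹ * c) • (monomial v 1 * (X a * X b) * g a' b') +
        c'⁻¹ • (monomial v 1 * t * g a' b' - monomial v 1 * t' * g a b) := by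
    have hC : (C c'⁻¹ * C c' : MvPolynomial σ K) = 1 := by
      rw [← C_mul, inv_mul_cancel₀ hc', C_1]
    simp only [smul_eq_C_mul, C_mul, hdt, hdt']
    linear_combination (-(monomial v 1 * (X a' * X b') * g a b)) * hC
  rw [key]
  refine Submodule.add_mem_sup (Submodule.smul_mem _ _ (Submodule.mem_span_singleton_self _))
    (Submodule.smul_mem _ _ (sub_mem ?_ ?_))
  · have := mul_mem_relationSpan (mul_mem_upperSpan (monomial_mem_upperSpan (K := K) w v) ht)
      (mem_relationSpan_two g w h')
    refine relationSpan_anti r g w _ (le_of_eq ?_) this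
    ring
  · have := mul_mem_relationSpan (mul_mem_upperSpan (monomial_mem_upperSpan (K := K) w v) ht')
      (mem_relationSpan_two g w h)
    refine relationSpan_anti r g w _ (le_of_eq ?_) this
    ring

/-- The analogue of Buchberger's criterion: two multiples with the same leading monomial are
interchangeable up to a scalar and higher weight. Symmetry reduces a shared variable to `left`;
otherwise the Koszul case applies. -/
theorem resolve (hg : IsConfluent r g w) {a b a' b' : σ} {u u' : σ →₀ ℕ}
    (h : r a b) (h' : r a' b')
    (hu : u + (Finsupp.single a 1 + Finsupp.single b 1) =
      u' + (Finsupp.single a' 1 + Finsupp.single b' 1)) :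
    monomial u 1 * g a b ∈ Submodule.span K {monomial u' 1 * g a' b'} ⊔
      relationSpan r g w (u.degree + 2) (Finsupp.weight w u + w a + w b + 1) := by
  have left : ∀ {a b a' b' : σ}, r a b → r a' b' →
      u + (Finsupp.single a 1 + Finsupp.single b 1) =
        u' + (Finsupp.single a' 1 + Finsupp.single b' 1) → a = a' →
      monomial u 1 * g a b ∈ Submodule.span K {monomial u' 1 * g a' b'} ⊔
        relationSpan r g w (u.degree + 2) (Finsupp.weight w u + w a + w b + 1) := by
    rintro a b a' b' h h' hu rfl
    refine hg.resolve_of_left_eq h h' (add_right_cancel (b := Finsupp.single a 1) ?_)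
    rw [add_assoc, add_assoc, add_comm (Finsupp.single b 1), hu,
      add_comm (Finsupp.single b' 1)]
  have comm : ∀ x y : σ, Finsupp.single x 1 + Finsupp.single y 1 =
      (Finsupp.single y 1 + Finsupp.single x 1 : σ →₀ ℕ) := fun x y => add_comm _ _
  by_cases h1 : a = a'
  · exact left h h' hu h1
  by_cases h2 : a = b'
  · rw [hg.comm a' b']
    exact left h (hg.symm _ _ h') (by rw [hu, comm a']) h2
  by_cases h3 : b = a'
  · have := left (hg.symm _ _ h) h' (by rw [← hu, comm a]) h3
    rwa [hg.comm b a, add_right_comm (Finsupp.weight w u)] at this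
  by_cases h4 : b = b'
  · have := left (hg.symm _ _ h) (hg.symm _ _ h') (by rw [comm b, hu, comm a']) h4
    rwa [hg.comm b a, hg.comm b' a', add_right_comm (Finsupp.weight w u)] at this
  -- Irreflexivity makes the leading monomial squarefree, so each variable has to divide `u` only
  -- once.
  have hab : a' ≠ b' := by
    rintro rfl
    exact hg.irrefl _ h'
  have hle : Finsupp.single a' 1 + Finsupp.single b' 1 ≤ u := by
    intro x
    have := DFunLike.congr_fun hu x
    classical
    simp only [Finsupp.add_apply, Finsupp.single_apply] at this ⊢
    split_ifs at * <;> first | omega | (subst_vars; contradiction)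
  obtain ⟨v, rfl⟩ := exists_add_of_le hle
  obtain rfl : u' = v + (Finsupp.single a 1 + Finsupp.single b 1) := by
    apply add_right_cancel (b := Finsupp.single a' 1 + Finsupp.single b' 1)
    rw [← hu]
    abel
  have e : ∀ x y : σ, monomial (v + (Finsupp.single x 1 + Finsupp.single y 1)) (1 : K) =
      monomial v 1 * (X x * X y) := by
    intro x y
    simp only [X, monomial_mul, mul_one]
  rw [add_comm _ v, e, e]
  convert hg.resolve_of_disjoint v h h' using 3
  · simp
  · simp only [map_add, Finsupp.weight_single, smul_eq_mul, one_mul]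
    ring

end IsConfluent

theorem upperSpan_zero_eq_homogeneousSubmodule (w : σ → ℕ) (n : ℕ) :
    upperSpan K w n 0 = homogeneousSubmodule σ K n := by
  apply le_antisymm
  · rw [upperSpan, Submodule.span_le]
    rintro _ ⟨u, hu, -, rfl⟩
    exact isHomogeneous_monomial 1 hu
  · intro p hp
    rw [p.as_sum]
    refine sum_mem fun u hu => ?_
    have : monomial u (coeff u p) = coeff u p • monomial u (1 : K) := by
      rw [smul_monomial, smul_eq_mul, mul_one]
    rw [this]
    refine Submodule.smul_mem _ _ (Submodule.subset_span ⟨u, ?_, Nat.zero_le _, rfl⟩)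
    by_contra h
    exact mem_support_iff.1 hu (IsHomogeneous.coeff_eq_zero hp h)

/-- Descending induction on the weight, which terminates because weights of monomials of a fixed
degree in finitely many variables are bounded. -/
theorem span_le_of_step {V : Type*} [AddCommGroup V] [Module K V] (T : ℕ → Submodule K V)
    (S : Submodule K V) (B : ℕ) (hB : ∀ N, B < N → T N ≤ S)
    (hT : ∀ N, T (N + 1) ≤ S → T N ≤ S) (N : ℕ) : T N ≤ S := by
  obtain ⟨k, hk⟩ : ∃ k, B < N + k := ⟨B + 1, by omega⟩
  induction k generalizing N with
  | zero => exact hB N hk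
  | succ k ih => exact hT N (ih (N + 1) (by omega))

/-- A monomial not divisible by the product of two related variables. -/
def IsStandard (r : σ → σ → Prop) (m : σ →₀ ℕ) : Prop := ∀ a b, r a b → m a = 0 ∨ m b = 0

theorem exists_of_not_isStandard {r : σ → σ → Prop} (hr : ∀ a, ¬r a a) {m : σ →₀ ℕ}
    (h : ¬IsStandard r m) : ∃ u a b, r a b ∧
      u + (Finsupp.single a 1 + Finsupp.single b 1) = m := by
  simp only [IsStandard, not_forall, not_or] at h
  obtain ⟨a, b, hab, ha, hb⟩ := h
  have hne : a ≠ b := by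
    rintro rfl
    exact hr _ hab
  have hle : Finsupp.single a 1 + Finsupp.single b 1 ≤ m := by
    intro x
    classical
    simp only [Finsupp.add_apply, Finsupp.single_apply]
    split_ifs <;> subst_vars <;> first | contradiction | omega
  obtain ⟨u, rfl⟩ := exists_add_of_le hle
  exact ⟨u, a, b, hab, add_comm _ _⟩

open Classical in
/-- A monomial multiple of one of the quadrics, with leading monomial `m`, if there is one, and
the monomial `m` otherwise. -/
noncomputable def adaptedFamily {r : σ → σ → Prop} (hr : ∀ a, ¬r a a)
    (g : σ → σ → MvPolynomial σ K) (m : σ →₀ ℕ) : MvPolynomial σ K :=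
  if h : IsStandard r m then monomial m 1 else
    monomial (exists_of_not_isStandard hr h).choose 1 *
      g (exists_of_not_isStandard hr h).choose_spec.choose
        (exists_of_not_isStandard hr h).choose_spec.choose_spec.choose

theorem adaptedFamily_of_isStandard {r : σ → σ → Prop} (hr : ∀ a, ¬r a a)
    (g : σ → σ → MvPolynomial σ K) {m : σ →₀ ℕ} (h : IsStandard r m) :
    adaptedFamily hr g m = monomial m 1 := dif_pos h

theorem adaptedFamily_of_not_isStandard {r : σ → σ → Prop} (hr : ∀ a, ¬r a a)
    (g : σ → σ → MvPolynomial σ K) {m : σ →₀ ℕ} (h : ¬IsStandard r m) :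
    ∃ u a b, r a b ∧ u + (Finsupp.single a 1 + Finsupp.single b 1) = m ∧
      adaptedFamily hr g m = monomial u 1 * g a b :=
  ⟨_, _, _, (exists_of_not_isStandard hr h).choose_spec.choose_spec.choose_spec.1,
    (exists_of_not_isStandard hr h).choose_spec.choose_spec.choose_spec.2, dif_neg h⟩

theorem not_isStandard_add {r : σ → σ → Prop} (u : σ →₀ ℕ) {a b : σ} (h : r a b) :
    ¬IsStandard r (u + (Finsupp.single a 1 + Finsupp.single b 1)) := by
  intro hs
  rcases hs a b h with h | h <;> simp at h

namespace IsConfluent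

variable {r : σ → σ → Prop} {g : σ → σ → MvPolynomial σ K} {w : σ → ℕ}

theorem adaptedFamily_mem_upperSpan (hg : IsConfluent r g w) (m : σ →₀ ℕ) :
    ∃ c : K, c ≠ 0 ∧ adaptedFamily hg.irrefl g m - c • monomial m 1 ∈
      upperSpan K w m.degree (Finsupp.weight w m + 1) := by
  by_cases h : IsStandard r m
  · exact ⟨1, one_ne_zero, by simp [adaptedFamily_of_isStandard hg.irrefl g h]⟩
  · obtain ⟨u, a, b, hab, rfl, hm⟩ := adaptedFamily_of_not_isStandard hg.irrefl g h
    obtain ⟨c, hc, ht⟩ := hg.lead a b hab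
    refine ⟨c, hc, ?_⟩
    have h1 := mul_mem_upperSpan (monomial_mem_upperSpan (K := K) w u) ht
    have h2 : monomial (u + (Finsupp.single a 1 + Finsupp.single b 1)) (1 : K) =
        monomial u 1 * (X a * X b) := by
      simp only [X, monomial_mul, mul_one]
    rw [hm, h2, smul_eq_C_mul]
    convert h1 using 1
    · simp [Finsupp.weight_single, add_assoc]
    · ring

theorem isHomogeneous_quadric (hg : IsConfluent r g w) {a b : σ} (h : r a b) :
    (g a b).IsHomogeneous 2 := by
  have := upperSpan_anti w 2 (Nat.zero_le _) (hg.quadric_mem_upperSpan h)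
  rwa [upperSpan_zero_eq_homogeneousSubmodule] at this

theorem homogeneousComponent_mem_relationSpan (hg : IsConfluent r g w) (n : ℕ)
    {p : MvPolynomial σ K} (hp : p ∈ Ideal.span {q | ∃ a b, r a b ∧ q = g a b}) :
    homogeneousComponent n p ∈ relationSpan r g w n 0 := by
  -- An arbitrary multiplier is carried along so that the induction on the ideal span survives
  -- multiplication by scalars from the polynomial ring.
  suffices h : ∀ q : MvPolynomial σ K, homogeneousComponent n (q * p) ∈ relationSpan r g w n 0 by
    simpa using h 1
  induction hp using Submodule.span_induction with
  | mem x hx =>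
    obtain ⟨a, b, hab, rfl⟩ := hx
    intro q
    induction q using MvPolynomial.induction_on' with
    | monomial u c =>
      have hu : (monomial u c * g a b).IsHomogeneous (u.degree + 2) :=
        (isHomogeneous_monomial c rfl).mul (hg.isHomogeneous_quadric hab)
      rw [homogeneousComponent_of_mem hu]
      split_ifs with h
      · have hc : monomial u c * g a b = c • (monomial u 1 * g a b) := by
          rw [← smul_mul_assoc, smul_monomial, smul_eq_mul, mul_one]
        rw [hc]
        exact Submodule.smul_mem _ _
          (Submodule.subset_span ⟨u, a, b, hab, h.symm, Nat.zero_le _, rfl⟩)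
      · exact zero_mem _
    | add p q hp hq =>
      rw [add_mul, map_add]
      exact add_mem hp hq
  | zero => simp
  | add x y _ _ hx hy =>
    intro q
    rw [mul_add, map_add]
    exact add_mem (hx q) (hy q)
  | smul q x hx ih =>
    intro q'
    rw [smul_eq_mul, ← mul_assoc]
    exact ih _

theorem adaptedFamily_mem_ideal (hg : IsConfluent r g w) {m : σ →₀ ℕ} (h : ¬IsStandard r m) :
    adaptedFamily hg.irrefl g m ∈ Ideal.span {q | ∃ a b, r a b ∧ q = g a b} := by
  obtain ⟨u, a, b, hab, -, hm⟩ := adaptedFamily_of_not_isStandard hg.irrefl g h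
  rw [hm]
  exact Ideal.mul_mem_left _ _ (Ideal.subset_span ⟨a, b, hab, rfl⟩)

variable [Finite σ]

theorem exists_weight_bound (w : σ → ℕ) (n : ℕ) :
    ∃ B, ∀ u : σ →₀ ℕ, u.degree = n → Finsupp.weight w u ≤ B := by
  have hfin : {u : σ →₀ ℕ | u.degree = n}.Finite :=
    (Finsupp.finite_of_degree_le n).subset fun u hu => le_of_eq hu
  obtain ⟨B, hB⟩ := (hfin.image (Finsupp.weight w)).bddAbove
  exact ⟨B, fun u hu => hB ⟨u, hu, rfl⟩⟩

/-- Confluence enters here: any multiple of a quadric may be replaced by the chosen one with the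
same leading monomial, at the cost of multiples of higher weight, which descending induction
handles. -/
theorem relationSpan_le (hg : IsConfluent r g w) (n N : ℕ) :
    relationSpan r g w n N ≤ Submodule.span K (adaptedFamily hg.irrefl g ''
      {m | m.degree = n ∧ ¬IsStandard r m}) := by
  obtain ⟨B, hB⟩ := exists_weight_bound w n
  refine span_le_of_step _ _ B (fun N hN => ?_) (fun N hN => ?_) N
  · rw [relationSpan, Submodule.span_le]
    rintro _ ⟨u, a, b, hab, hu, hu', rfl⟩
    have := hB (u + (Finsupp.single a 1 + Finsupp.single b 1)) (by simpa using hu)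
    simp [Finsupp.weight_single] at this
    omega
  · rw [relationSpan, Submodule.span_le]
    rintro _ ⟨u, a, b, hab, hu, hu', rfl⟩
    rcases hu'.eq_or_lt with h | h
    · have hns := not_isStandard_add u hab
      obtain ⟨u', a', b', hab', hm, hf⟩ := adaptedFamily_of_not_isStandard hg.irrefl g hns
      have h1 := hg.resolve hab hab' hm.symm
      refine SetLike.le_def.1 (sup_le ?_ ?_) h1
      · rw [Submodule.span_le, Set.singleton_subset_iff, ← hf]
        exact Submodule.subset_span ⟨_, ⟨by simpa using hu, hns⟩, rfl⟩
      · rwa [hu, ← h]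
    · exact hN (Submodule.subset_span ⟨u, a, b, hab, hu, h, rfl⟩)

/-- The adapted family is triangular with nonzero diagonal relative to the monomials, so each
monomial is recovered modulo higher weight. -/
theorem upperSpan_le (hg : IsConfluent r g w) (n N : ℕ) :
    upperSpan K w n N ≤ Submodule.span K (adaptedFamily hg.irrefl g '' {m | m.degree = n}) := by
  obtain ⟨B, hB⟩ := exists_weight_bound w n
  refine span_le_of_step _ _ B (fun N hN => ?_) (fun N hN => ?_) N
  · rw [upperSpan, Submodule.span_le]
    rintro _ ⟨u, hu, hu', rfl⟩
    have := hB u hu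
    omega
  · rw [upperSpan, Submodule.span_le]
    rintro _ ⟨u, hu, hu', rfl⟩
    rcases hu'.eq_or_lt with h | h
    · obtain ⟨c, hc, ht⟩ := hg.adaptedFamily_mem_upperSpan u
      rw [hu, ← h] at ht
      have h1 := sub_mem (Submodule.subset_span ⟨u, hu, rfl⟩ :
        adaptedFamily hg.irrefl g u ∈ Submodule.span K (adaptedFamily hg.irrefl g ''
          {m | m.degree = n})) (hN ht)
      rw [sub_sub_cancel] at h1
      exact (Submodule.smul_mem_iff _ hc).1 h1
    · exact hN (Submodule.subset_span ⟨u, hu, h, rfl⟩)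

theorem span_adaptedFamily (hg : IsConfluent r g w) (n : ℕ) :
    Submodule.span K (adaptedFamily hg.irrefl g '' {m | m.degree = n}) =
      homogeneousSubmodule σ K n := by
  rw [← upperSpan_zero_eq_homogeneousSubmodule w]
  refine le_antisymm ?_ (hg.upperSpan_le n 0)
  rw [Submodule.span_le]
  rintro _ ⟨m, rfl, rfl⟩
  obtain ⟨c, -, ht⟩ := hg.adaptedFamily_mem_upperSpan m
  have := add_mem (upperSpan_anti w m.degree (Nat.zero_le _) ht) (Submodule.smul_mem _ c
    (upperSpan_anti w m.degree (Nat.zero_le _) (monomial_mem_upperSpan (K := K) w m)))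
  simpa using this

/-- The family spans the degree `n` part and is indexed by the monomials of degree `n`, so its
cardinality equals the dimension. -/
theorem linearIndependent_adaptedFamily (hg : IsConfluent r g w) (n : ℕ) :
    LinearIndependent K
      (fun m : {m : σ →₀ ℕ | m.degree = n} => adaptedFamily hg.irrefl g m) := by
  have hfin : {m : σ →₀ ℕ | m.degree = n}.Finite :=
    (Finsupp.finite_of_degree_le n).subset fun u hu => le_of_eq hu
  have := hfin.fintype
  have hli : LinearIndependent K
      (fun m : {m : σ →₀ ℕ | m.degree = n} => monomial (m : σ →₀ ℕ) (1 : K)) := by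
    have := (basisMonomials σ K).linearIndependent.comp
      (Subtype.val : {m : σ →₀ ℕ | m.degree = n} → _) Subtype.val_injective
    rw [coe_basisMonomials] at this
    exact this
  rw [linearIndependent_iff_card_eq_finrank_span, Set.finrank]
  have h1 : Set.range (fun m : {m : σ →₀ ℕ | m.degree = n} => adaptedFamily hg.irrefl g m) =
      adaptedFamily hg.irrefl g '' {m | m.degree = n} := by
    rw [← Set.image_eq_range]
  have h2 : Submodule.span K
      (Set.range (fun m : {m : σ →₀ ℕ | m.degree = n} => monomial (m : σ →₀ ℕ) (1 : K))) =
      homogeneousSubmodule σ K n := by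
    rw [← upperSpan_zero_eq_homogeneousSubmodule w, upperSpan]
    congr 1
    ext p
    simp [eq_comm]
  rw [h1, hg.span_adaptedFamily, ← h2, finrank_span_eq_card hli]

/-- The Hilbert function of the quotient by a confluent family of quadrics counts the standard
monomials. -/
theorem finrank_homogeneousSubmodule_map (hg : IsConfluent r g w) (n : ℕ)
    {I : Ideal (MvPolynomial σ K)} (hI : I = Ideal.span {q | ∃ a b, r a b ∧ q = g a b}) :
    Module.finrank K ((homogeneousSubmodule σ K n).map
      (Ideal.Quotient.mkₐ K I).toLinearMap) =
      Nat.card {m : σ →₀ ℕ | m.degree = n ∧ IsStandard r m} := by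
  set π := (Ideal.Quotient.mkₐ K I).toLinearMap with hπ
  set F := adaptedFamily hg.irrefl g
  have hker : ∀ p, π p = 0 ↔ p ∈ I := fun p => Ideal.Quotient.eq_zero_iff_mem
  have hfin : {m : σ →₀ ℕ | m.degree = n ∧ IsStandard r m}.Finite :=
    (Finsupp.finite_of_degree_eq n).subset fun u hu => hu.1
  have := hfin.fintype
  have hli := hg.linearIndependent_adaptedFamily n
  have hdisj : Disjoint (Submodule.span K (F '' {m | m.degree = n ∧ IsStandard r m}))
      (Submodule.span K (F '' {m | m.degree = n ∧ ¬IsStandard r m})) := by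
    have := hli.disjoint_span_image (s := {m | IsStandard r m.1}) (t := {m | ¬IsStandard r m.1})
      (Set.disjoint_left.2 fun m h h' => h' h)
    convert this using 2 <;>
    · ext p
      simp only [Set.mem_image, Set.mem_ofPred_eq, Subtype.exists, exists_and_left, exists_prop, F]
      grind
  have hli' : LinearIndependent K
      (fun m : {m : σ →₀ ℕ | m.degree = n ∧ IsStandard r m} => F m) :=
    hli.comp (fun m : {m : σ →₀ ℕ | m.degree = n ∧ IsStandard r m} => ⟨m.1, m.2.1⟩)
      fun a b h => Subtype.ext (congrArg (fun x => x.1) h)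
  have hmap : LinearIndependent K (π ∘
      (fun m : {m : σ →₀ ℕ | m.degree = n ∧ IsStandard r m} => F m)) := by
    -- A combination of standard members lying in the ideal equals its own component of degree `n`,
    -- hence is also a combination of nonstandard members; independence of the whole family makes it
    -- zero.
    refine hli'.map (Submodule.disjoint_def.2 fun p hp hp' => ?_)
    rw [← Set.image_eq_range] at hp
    refine Submodule.disjoint_def.1 hdisj p hp ?_
    have hp1 : p ∈ homogeneousSubmodule σ K n := by
      rw [← hg.span_adaptedFamily n]
      exact Submodule.span_mono (Set.image_mono fun m hm => hm.1) hp
    have hp2 : p ∈ I := (hker p).1 hp'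
    rw [hI] at hp2
    have hp3 := hg.homogeneousComponent_mem_relationSpan n hp2
    rw [homogeneousComponent_of_mem hp1, if_pos rfl] at hp3
    exact hg.relationSpan_le n 0 hp3
  have hspan : (homogeneousSubmodule σ K n).map π = Submodule.span K (Set.range (π ∘
      (fun m : {m : σ →₀ ℕ | m.degree = n ∧ IsStandard r m} => F m))) := by
    rw [← hg.span_adaptedFamily n, Submodule.map_span]
    apply le_antisymm
    · rw [Submodule.span_le]
      rintro _ ⟨_, ⟨m, hm, rfl⟩, rfl⟩
      by_cases h : IsStandard r m
      · exact Submodule.subset_span ⟨⟨m, hm, h⟩, rfl⟩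
      · have h0 : π (F m) = 0 := by
          rw [hker, hI]
          exact hg.adaptedFamily_mem_ideal h
        rw [SetLike.mem_coe, h0]
        exact zero_mem _
    · refine Submodule.span_mono ?_
      rintro _ ⟨⟨m, hm⟩, rfl⟩
      exact ⟨F m, ⟨m, hm.1, rfl⟩, rfl⟩
  rw [hspan, finrank_span_eq_card hmap, Nat.card_eq_fintype_card]

end IsConfluent

end WeightedGroebner

/-! ### Confluence of the Richardson relations -/

open Classical in
/-- The variable `λ^v`, or zero if `v` is not in the interval `[a, b]`. -/
noncomputable def intervalVar (a b v : AffVertex) : IntervalPoly a b :=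
  if h : v ∈ Set.Icc a b then MvPolynomial.X ⟨v, h⟩ else 0

theorem intervalVar_of_mem {a b v : AffVertex} (h : v ∈ Set.Icc a b) :
    intervalVar a b v = MvPolynomial.X ⟨v, h⟩ := dif_pos h

theorem intervalVar_of_notMem {a b v : AffVertex} (h : v ∉ Set.Icc a b) :
    intervalVar a b v = 0 := dif_neg h

theorem AffVertex.deg_mem_Icc {a b v : AffVertex} (h : v ∈ Set.Icc a b) :
    v.deg ∈ Finset.Icc a.deg b.deg :=
  Finset.mem_Icc.2 ⟨deg_le_of_le h.1, deg_le_of_le h.2⟩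

theorem LaurentPolynomial.coeff_C_mul_T_mul {R : Type*} [CommRing R] (c : R) (l k : ℤ)
    (f : LaurentPolynomial R) :
    (LaurentPolynomial.C c * LaurentPolynomial.T l * f).coeff k = c * f.coeff (k - l) := by
  have h := AddMonoidAlgebra.coeff_single_mul_add f c l (k - l)
  rwa [add_sub_cancel, LaurentPolynomial.single_eq_C_mul_T] at h

theorem LaurentPolynomial.coeff_sum {R ι : Type*} [CommRing R] (s : Finset ι)
    (f : ι → LaurentPolynomial R) (k : ℤ) : (∑ i ∈ s, f i).coeff k = ∑ i ∈ s, (f i).coeff k := by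
  classical
  induction s using Finset.induction_on with
  | empty => simp
  | insert i s hi ih =>
    rw [Finset.sum_insert hi, Finset.sum_insert hi, AddMonoidAlgebra.coeff_add, Finsupp.add_apply,
      ih]

theorem spinorGen_eq_sum (a b : AffVertex) (α : SpinorWeight) :
    spinorGen a b α = ∑ l ∈ Finset.Icc a.deg b.deg,
      LaurentPolynomial.C (intervalVar a b ⟨α, l⟩) * LaurentPolynomial.T l := by
  refine Finset.sum_congr rfl fun l _ => ?_
  by_cases h : (⟨α, l⟩ : AffVertex) ∈ Set.Icc a b
  · rw [dif_pos h, intervalVar_of_mem h]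
  · rw [dif_neg h, intervalVar_of_notMem h, map_zero, zero_mul]

theorem coeff_spinorGen_mul (a b : AffVertex) (α : SpinorWeight) (k : ℤ)
    (f : LaurentPolynomial (IntervalPoly a b)) :
    (spinorGen a b α * f).coeff k =
      ∑ l ∈ Finset.Icc a.deg b.deg, intervalVar a b ⟨α, l⟩ * f.coeff (k - l) := by
  rw [spinorGen_eq_sum, Finset.sum_mul, LaurentPolynomial.coeff_sum]
  exact Finset.sum_congr rfl fun l _ => LaurentPolynomial.coeff_C_mul_T_mul _ _ _ _

theorem coeff_spinorGen (a b : AffVertex) (α : SpinorWeight) (k : ℤ) :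
    (spinorGen a b α).coeff k = intervalVar a b ⟨α, k⟩ := by
  have h := coeff_spinorGen_mul a b α k 1
  rw [mul_one] at h
  rw [h, Finset.sum_eq_single k]
  · rw [sub_self, AddMonoidAlgebra.one_def, AddMonoidAlgebra.coeff_single, Finsupp.single_eq_same,
      mul_one]
  · intro l _ hl
    rw [AddMonoidAlgebra.one_def, AddMonoidAlgebra.coeff_single, Finsupp.single_apply,
      if_neg (by omega), mul_zero]
  · intro hk
    rw [intervalVar_of_notMem fun h => hk (AffVertex.deg_mem_Icc h), zero_mul]

theorem LaurentPolynomial.coeff_intCast_mul {R : Type*} [CommRing R] (c : ℤ) (k : ℤ)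
    (f : LaurentPolynomial R) : ((c : LaurentPolynomial R) * f).coeff k = (c : R) * f.coeff k := by
  have := LaurentPolynomial.coeff_C_mul_T_mul (c : R) 0 k f
  simpa using this

theorem affRelation_eq_sum (a b : AffVertex) (s : VectorIndex) (k : ℤ) :
    affRelation a b s k = ∑ p ∈ Finset.univ ×ˢ Finset.Icc a.deg b.deg,
      (quadricSign s p.1 : IntervalPoly a b) *
        (intervalVar a b ⟨quadricFst s p.1, p.2⟩ *
          intervalVar a b ⟨quadricSnd s p.1, k - p.2⟩) := by
  rw [affRelation, pureSpinorQuadric_eq_sum, LaurentPolynomial.coeff_sum, Finset.sum_product]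
  refine Finset.sum_congr rfl fun i _ => ?_
  rw [LaurentPolynomial.coeff_intCast_mul, coeff_spinorGen_mul, Finset.mul_sum]
  simp only [coeff_spinorGen]

theorem sum_syzygy_affRelation (a b : AffVertex) (σ : SpinorWeight) (k : ℤ) :
    ∑ p ∈ Finset.univ ×ˢ Finset.Icc a.deg b.deg,
      (syzygySign σ p.1 : IntervalPoly a b) *
        (intervalVar a b ⟨syzygyWeight σ p.1, p.2⟩ *
          affRelation a b (syzygyIndex σ p.1) (k - p.2)) = 0 := by
  have h := congrArg (fun f => f.coeff k) (sum_syzygy_eq_zero (spinorGen a b) σ)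
  simp only [LaurentPolynomial.coeff_sum, LaurentPolynomial.coeff_intCast_mul,
    coeff_spinorGen_mul, AddMonoidAlgebra.coeff_zero, Finsupp.zero_apply] at h
  rw [Finset.sum_product]
  simp only [Finset.mul_sum] at h
  exact h

/-- Intervals are convex: if both factors of some monomial survive in [a, b], so does the
incomparable pair, which lies between them. Truncation thus never removes the leading term alone. -/
theorem affRelation_eq_zero {a b : AffVertex} {s : VectorIndex} {k : ℤ}
    (h : ¬(leadFst s k ∈ Set.Icc a b ∧ leadSnd s k ∈ Set.Icc a b)) : affRelation a b s k = 0 := by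
  rw [affRelation_eq_sum]
  refine Finset.sum_eq_zero fun p _ => ?_
  by_cases h1 : (⟨quadricFst s p.1, p.2⟩ : AffVertex) ∈ Set.Icc a b
  · by_cases h2 : (⟨quadricSnd s p.1, k - p.2⟩ : AffVertex) ∈ Set.Icc a b
    · refine absurd ?_ h
      rcases eq_or_le_lead s k p.1 p.2 with ⟨h3, h4⟩ | ⟨h3, h4, h5, h6⟩ | ⟨h3, h4, h5, h6⟩
      · rw [h3, h4] at h1 h2
        exact ⟨h1, h2⟩
      · exact ⟨⟨h1.1.trans h3, h5.trans h2.2⟩, ⟨h1.1.trans h4, h6.trans h2.2⟩⟩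
      · exact ⟨⟨h2.1.trans h3, h5.trans h1.2⟩, ⟨h2.1.trans h4, h6.trans h1.2⟩⟩
    · rw [intervalVar_of_notMem h2, mul_zero, mul_zero]
  · rw [intervalVar_of_notMem h1, zero_mul, mul_zero]

/-- The relation in which the product of the variables `λ^u` and `λ^v` occurs. -/
noncomputable def pairRelation (a b : AffVertex) (u v : Set.Icc a b) : IntervalPoly a b :=
  affRelation a b (quadricOf u.1.wt v.1.wt) (u.1.deg + v.1.deg)

/-- The square of the height of a vertex. -/
def heightSq {a b : AffVertex} (v : Set.Icc a b) : ℕ := v.1.height.natAbs ^ 2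

theorem heightSq_cast {a b : AffVertex} (v : Set.Icc a b) :
    (heightSq v : ℤ) = v.1.height ^ 2 := by
  simp [heightSq]

theorem affRelation_eq_pairRelation {a b : AffVertex} {s : VectorIndex} {k : ℤ}
    (h : leadFst s k ∈ Set.Icc a b) (h' : leadSnd s k ∈ Set.Icc a b) :
    affRelation a b s k = pairRelation a b ⟨_, h⟩ ⟨_, h'⟩ := by
  rw [pairRelation, quadricOf_lead, leadFst_deg_add_leadSnd_deg]

theorem pairRelation_comm (a b : AffVertex) (u v : Set.Icc a b) :
    pairRelation a b u v = pairRelation a b v u := by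
  rw [pairRelation, pairRelation, quadricOf_comm, add_comm]

theorem richardsonIdeal_eq_span (a b : AffVertex) :
    richardsonIdeal a b = Ideal.span {f | ∃ u v : Set.Icc a b, u.1.Incomp v.1 ∧
      f = pairRelation a b u v} := by
  refine le_antisymm (Ideal.span_le.2 ?_) (Ideal.span_mono ?_)
  · rintro _ ⟨s, k, rfl⟩
    by_cases h : leadFst s k ∈ Set.Icc a b ∧ leadSnd s k ∈ Set.Icc a b
    · exact Ideal.subset_span ⟨⟨_, h.1⟩, ⟨_, h.2⟩, leadFst_incomp_leadSnd s k,
        affRelation_eq_pairRelation h.1 h.2⟩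
    · rw [affRelation_eq_zero h]
      exact zero_mem _
  · rintro _ ⟨u, v, -, rfl⟩
    exact ⟨_, _, rfl⟩

theorem sum_sub_mem {ι R M : Type*} [Ring R] [AddCommGroup M] [Module R M] (S : Submodule R M)
    (s : Finset ι) (f : ι → M) {i : ι} (hi : i ∈ s) (h : ∀ j ∈ s, j ≠ i → f j ∈ S) :
    ∑ j ∈ s, f j - f i ∈ S := by
  classical
  rw [← Finset.add_sum_erase s f hi, add_sub_cancel_left]
  exact sum_mem fun j hj => h j (Finset.mem_of_mem_erase hj) (Finset.ne_of_mem_erase hj)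

theorem intCast_mul_mem {σ : Type*} {S : Submodule ℂ (MvPolynomial σ ℂ)} (c : ℤ)
    {p : MvPolynomial σ ℂ} (h : p ∈ S) : (c : MvPolynomial σ ℂ) * p ∈ S := by
  rw [← zsmul_eq_mul]
  exact zsmul_mem h c

theorem exists_lead_affRelation {a b : AffVertex} {s : VectorIndex} {k : ℤ}
    (h : leadFst s k ∈ Set.Icc a b) (h' : leadSnd s k ∈ Set.Icc a b) :
    ∃ c : ℂ, c ≠ 0 ∧ affRelation a b s k -
      MvPolynomial.C c * (MvPolynomial.X ⟨_, h⟩ * MvPolynomial.X ⟨_, h'⟩) ∈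
        upperSpan ℂ heightSq 2
          (heightSq (⟨_, h⟩ : Set.Icc a b) + heightSq (⟨_, h'⟩ : Set.Icc a b) + 1) := by
  have hsign : ∀ s i, quadricSign s i ≠ 0 := by decide
  refine ⟨(quadricSign s (leadPosition s k) : ℤ), by exact_mod_cast hsign _ _, ?_⟩
  rw [affRelation_eq_sum, map_intCast, ← intervalVar_of_mem h, ← intervalVar_of_mem h']
  refine sum_sub_mem _ _ (fun p : Fin 4 × ℤ => _) (i := (leadPosition s k, leadDegree s k))
    (Finset.mem_product.2 ⟨Finset.mem_univ _, AffVertex.deg_mem_Icc h⟩) ?_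
  rintro ⟨i, l⟩ - hne
  refine intCast_mul_mem _ ?_
  by_cases h1 : (⟨quadricFst s i, l⟩ : AffVertex) ∈ Set.Icc a b
  · by_cases h2 : (⟨quadricSnd s i, k - l⟩ : AffVertex) ∈ Set.Icc a b
    · rw [intervalVar_of_mem h1, intervalVar_of_mem h2]
      refine upperSpan_anti _ _ ?_ (X_mul_X_mem_upperSpan _ _ _)
      have := height_sq_lt s k i l fun hh => hne (Prod.ext hh.1 hh.2)
      zify
      simp only [heightSq_cast]
      omega
    · rw [intervalVar_of_notMem h2, mul_zero]
      exact zero_mem _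
  · rw [intervalVar_of_notMem h1, zero_mul]
    exact zero_mem _

theorem exists_lead_pairRelation {a b : AffVertex} {u v : Set.Icc a b} (h : u.1.Incomp v.1) :
    ∃ c : ℂ, c ≠ 0 ∧ pairRelation a b u v -
      MvPolynomial.C c * (MvPolynomial.X u * MvPolynomial.X v) ∈
        upperSpan ℂ heightSq 2 (heightSq u + heightSq v + 1) := by
  obtain ⟨u, hu⟩ := u
  obtain ⟨v, hv⟩ := v
  rcases eq_lead_of_incomp h with ⟨h1, h2⟩ | ⟨h1, h2⟩
  · simp only at h1 h2
    have := exists_lead_affRelation (h1 ▸ hu) (h2 ▸ hv)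
    simp only [← h1, ← h2] at this
    exact this
  · simp only at h1 h2
    have := exists_lead_affRelation (h1 ▸ hv) (h2 ▸ hu)
    simp only [← h1, ← h2] at this
    rwa [mul_comm (MvPolynomial.X _), add_comm (heightSq _)] at this

/-- One coefficient of a linear syzygy contains both overlapping products, up to sign; its other
terms vanish or have larger weight by `exists_syzygy`. -/
theorem overlap_pairRelation {a b : AffVertex} {u v v' : Set.Icc a b} (h : u.1.Incomp v.1)
    (h' : u.1.Incomp v'.1) (hne : v ≠ v') :
    MvPolynomial.X v' * pairRelation a b u v ∈
      Submodule.span ℂ {MvPolynomial.X v * pairRelation a b u v'} ⊔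
        relationSpan (fun u v : Set.Icc a b => u.1.Incomp v.1) (pairRelation a b) heightSq 3
          (heightSq u + heightSq v + heightSq v' + 1) := by
  obtain ⟨σ, t₁, t₂, h1, h2, h3, h4, h5, h6⟩ :=
    exists_syzygy h h' fun hh => hne (Subtype.ext hh)
  set S := Submodule.span ℂ {MvPolynomial.X v * pairRelation a b u v'} ⊔
        relationSpan (fun u v : Set.Icc a b => u.1.Incomp v.1) (pairRelation a b) heightSq 3
          (heightSq u + heightSq v + heightSq v' + 1) with hS
  set k := u.1.deg + v.1.deg + v'.1.deg with hk
  have hrest := sum_sub_mem S (Finset.univ ×ˢ Finset.Icc a.deg b.deg)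
    (fun p : Fin 5 × ℤ => (syzygySign σ p.1 : IntervalPoly a b) *
        (intervalVar a b ⟨syzygyWeight σ p.1, p.2⟩ *
          affRelation a b (syzygyIndex σ p.1) (k - p.2))) (i := (t₁, v'.1.deg))
    (Finset.mem_product.2 ⟨Finset.mem_univ _, AffVertex.deg_mem_Icc v'.2⟩) ?_
  · have e : k - v'.1.deg = u.1.deg + v.1.deg := by omega
    have hsign : ∀ σ t, syzygySign σ t = 1 ∨ syzygySign σ t = -1 := by decide
    rw [sum_syzygy_affRelation, zero_sub, neg_mem_iff] at hrest
    simp only [h1, h4, e] at hrest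
    rw [intervalVar_of_mem v'.2] at hrest
    change _ * (MvPolynomial.X v' * pairRelation a b u v) ∈ S at hrest
    rcases hsign σ t₁ with hs | hs
    · simpa [hs] using hrest
    · simpa [hs] using hrest
  · rintro ⟨t, l⟩ - htl
    refine intCast_mul_mem _ ?_
    simp only
    rcases h6 t l with h7 | ⟨rfl, rfl⟩ | h7
    · exact absurd (Prod.ext h7.1 h7.2) htl
    · have e : k - v.1.deg = u.1.deg + v'.1.deg := by omega
      rw [h2, h5, e, intervalVar_of_mem v.2]
      exact Submodule.mem_sup_left (Submodule.mem_span_singleton_self _)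
    · by_cases h8 : (⟨syzygyWeight σ t, l⟩ : AffVertex) ∈ Set.Icc a b
      · by_cases h9 : leadFst (syzygyIndex σ t) (k - l) ∈ Set.Icc a b ∧
          leadSnd (syzygyIndex σ t) (k - l) ∈ Set.Icc a b
        · rw [affRelation_eq_pairRelation h9.1 h9.2, intervalVar_of_mem h8]
          refine Submodule.mem_sup_right (Submodule.subset_span
            ⟨Finsupp.single ⟨_, h8⟩ 1, ⟨_, h9.1⟩, ⟨_, h9.2⟩, leadFst_incomp_leadSnd _ _,
              by simp, ?_, rfl⟩)
          simp only [Finsupp.weight_single, smul_eq_mul, one_mul]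
          zify
          simp only [heightSq_cast]
          omega
        · rw [affRelation_eq_zero h9, mul_zero]
          exact zero_mem _
      · rw [intervalVar_of_notMem h8, zero_mul]
        exact zero_mem _

theorem isConfluent_pairRelation (a b : AffVertex) :
    IsConfluent (fun u v : Set.Icc a b => u.1.Incomp v.1) (pairRelation a b) heightSq where
  symm _ _ h := h.symm
  irrefl _ h := h.1 le_rfl
  comm := pairRelation_comm a b
  lead _ _ := exists_lead_pairRelation
  overlap _ _ _ := overlap_pairRelation

theorem finrank_richardsonComponent (a b : AffVertex) (n : ℕ) :
    Module.finrank ℂ (richardsonComponent a b n) =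
      Nat.card {m : Set.Icc a b →₀ ℕ | m.degree = n ∧
        IsStandard (fun u v : Set.Icc a b => u.1.Incomp v.1) m} :=
  (isConfluent_pairRelation a b).finrank_homogeneousSubmodule_map n (richardsonIdeal_eq_span a b)

/-! ### Multichains and their generating functions -/

/-- The multisets of size `n` of pairwise comparable elements of `S`. -/
def multichains (S : Set AffVertex) (n : ℕ) : Set (AffVertex →₀ ℕ) :=
  {m | m.degree = n ∧ (∀ v, m v ≠ 0 → v ∈ S) ∧ ∀ u v, u.Incomp v → m u = 0 ∨ m v = 0}

theorem image_embDomain_eq_multichains (S : Set AffVertex) (n : ℕ) :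
    Finsupp.embDomain (Function.Embedding.subtype (· ∈ S)) ''
      {m : S →₀ ℕ | m.degree = n ∧ IsStandard (fun u v : S => u.1.Incomp v.1) m} =
      multichains S n := by
  have hdeg : ∀ m : S →₀ ℕ, (Finsupp.embDomain (Function.Embedding.subtype (· ∈ S)) m).degree =
      m.degree := by
    intro m
    rw [Finsupp.embDomain_eq_mapDomain, Finsupp.degree_mapDomain]
  have hval : ∀ (m : S →₀ ℕ) (v : S),
      Finsupp.embDomain (Function.Embedding.subtype (· ∈ S)) m v.1 = m v := fun m v =>
    Finsupp.embDomain_apply_self (Function.Embedding.subtype (· ∈ S)) m v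
  have hzero : ∀ (m : S →₀ ℕ) (v : AffVertex), v ∉ S →
      Finsupp.embDomain (Function.Embedding.subtype (· ∈ S)) m v = 0 := by
    intro m v hv
    refine Finsupp.embDomain_of_notMem_range _ _ _ ?_
    rintro ⟨u, rfl⟩
    exact hv u.2
  ext m
  constructor
  · rintro ⟨m, ⟨h1, h2⟩, rfl⟩
    refine ⟨by rw [hdeg, h1], fun v hv => ?_, fun u v huv => ?_⟩
    · by_contra h
      exact hv (hzero m v h)
    · by_cases hu : u ∈ S
      · by_cases hv : v ∈ S
        · have := h2 ⟨u, hu⟩ ⟨v, hv⟩ huv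
          rwa [← hval m ⟨u, hu⟩, ← hval m ⟨v, hv⟩] at this
        · exact Or.inr (hzero m v hv)
      · exact Or.inl (hzero m u hu)
  · rintro ⟨h1, h2, h3⟩
    have hm : Finsupp.embDomain (Function.Embedding.subtype (· ∈ S))
        (m.comapDomain Subtype.val Subtype.val_injective.injOn) = m := by
      ext v
      by_cases hv : v ∈ S
      · exact hval _ ⟨v, hv⟩
      · rw [hzero _ v hv]
        by_contra h
        exact hv (h2 v (Ne.symm h))
    refine ⟨m.comapDomain Subtype.val Subtype.val_injective.injOn, ⟨?_, fun u v huv => ?_⟩, hm⟩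
    · rw [← hdeg, hm, h1]
    · exact h3 u.1 v.1 huv

theorem card_isStandard (S : Set AffVertex) (n : ℕ) :
    Nat.card {m : S →₀ ℕ | m.degree = n ∧ IsStandard (fun u v : S => u.1.Incomp v.1) m} =
      (multichains S n).ncard := by
  rw [← image_embDomain_eq_multichains,
    Set.ncard_image_of_injective _ (Finsupp.embDomain_injective _)]
  rfl

theorem multichains_finite {S : Set AffVertex} (hS : S.Finite) (n : ℕ) :
    (multichains S n).Finite := by
  have := hS.to_subtype
  rw [← image_embDomain_eq_multichains]
  exact ((Finsupp.finite_of_degree_eq n).subset fun u hu => hu.1).image _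

/-- The generating function of the numbers of multichains in `S`. -/
noncomputable def multichainSeries (S : Set AffVertex) : PowerSeries ℂ :=
  PowerSeries.mk fun n => ((multichains S n).ncard : ℂ)

/-- At z = q = 1 the torus acts as the identity, so the traces are dimensions, and these count
standard monomials. -/
theorem deltaSeries_eq_multichainSeries (c : AffVertex) (r : ℤ) :
    deltaSeries c r = multichainSeries (Set.Icc c (deltaSeq r)) := by
  ext n
  simp only [deltaSeries, poincareSeries, multichainSeries, PowerSeries.coeff_mk]
  have hid : torusPolyAction c (deltaSeq r) 1 1 = AlgHom.id ℂ _ := by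
    refine MvPolynomial.algHom_ext fun v => ?_
    have : affChar 1 1 v.1 = 1 := by
      cases h : v.1.wt <;> simp [affChar, spinorChar, h]
    simp [torusPolyAction, this]
  have hrestrict : (torusAction c (deltaSeq r) 1 1).toLinearMap.restrict
      (torusAction_mem c (deltaSeq r) 1 1 n) = LinearMap.id := by
    ext ⟨x, hx⟩
    obtain ⟨p, rfl⟩ := Ideal.Quotient.mk_surjective x
    change torusAction c (deltaSeq r) 1 1 (Ideal.Quotient.mk _ p) = Ideal.Quotient.mk _ p
    have : torusAction c (deltaSeq r) 1 1 (Ideal.Quotient.mk _ p) =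
      Ideal.Quotient.mk _ (torusPolyAction c (deltaSeq r) 1 1 p) := rfl
    rw [this, hid]
    rfl
  have : Module.Finite ℂ (richardsonComponent c (deltaSeq r) n) :=
    Module.Finite.iff_fg.2 ((MvPolynomial.homogeneousSubmodule_fg _ _ n).map _)
  rw [hrestrict, LinearMap.trace_id, finrank_richardsonComponent, card_isStandard]

theorem multichains_zero (S : Set AffVertex) : multichains S 0 = {0} := by
  ext m
  simp only [multichains, Set.mem_ofPred_eq, Set.mem_singleton_iff]
  constructor
  · rintro ⟨h, -⟩
    exact (Finsupp.degree_eq_zero_iff m).1 h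
  · rintro rfl
    simp

theorem multichainSeries_empty : multichainSeries ∅ = 1 := by
  ext n
  simp only [multichainSeries, PowerSeries.coeff_mk, PowerSeries.coeff_one]
  split_ifs with h
  · subst h
    simp [multichains_zero]
  · have : multichains ∅ n = ∅ := by
      refine Set.eq_empty_iff_forall_notMem.2 fun m hm => h ?_
      have h0 : m = 0 := by
        ext v
        by_contra hv
        exact hm.2.1 v hv
      rw [← hm.1, h0, map_zero]
    simp [this]

theorem multichains_mono {S S' : Set AffVertex} (h : S ⊆ S') (n : ℕ) :
    multichains S n ⊆ multichains S' n :=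
  fun _ hm => ⟨hm.1, fun v hv => h (hm.2.1 v hv), hm.2.2⟩

theorem multichains_inter (S T : Set AffVertex) (n : ℕ) :
    multichains S n ∩ multichains T n = multichains (S ∩ T) n := by
  ext m
  constructor
  · rintro ⟨h1, h2⟩
    exact ⟨h1.1, fun v hv => ⟨h1.2.1 v hv, h2.2.1 v hv⟩, h1.2.2⟩
  · intro h
    exact ⟨multichains_mono Set.inter_subset_left n h, multichains_mono Set.inter_subset_right n h⟩

/-- A multichain outside both sets would have a member outside `S` and one outside `T`. These are
comparable, which contradicts one of the closure conditions. -/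
theorem multichains_union {S T : Set AffVertex} (n : ℕ)
    (hS : ∀ u v, v ∈ S → u ≤ v → u ∈ T → u ∈ S) (hT : ∀ u v, v ∈ T → u ≤ v → u ∈ S → u ∈ T) :
    multichains S n ∪ multichains T n = multichains (S ∪ T) n := by
  apply subset_antisymm
  · exact Set.union_subset (multichains_mono Set.subset_union_left n)
      (multichains_mono Set.subset_union_right n)
  · intro m hm
    by_contra h
    rw [Set.mem_union, not_or] at h
    have h1 : ∃ u, m u ≠ 0 ∧ u ∉ S := by
      by_contra! h1
      exact h.1 ⟨hm.1, h1, hm.2.2⟩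
    have h2 : ∃ u, m u ≠ 0 ∧ u ∉ T := by
      by_contra! h2
      exact h.2 ⟨hm.1, h2, hm.2.2⟩
    obtain ⟨u, hu, huS⟩ := h1
    obtain ⟨v, hv, hvT⟩ := h2
    have huT := (hm.2.1 u hu).resolve_left huS
    have hvS := (hm.2.1 v hv).resolve_right hvT
    rcases hm.2.2 u v |> mt <| by simp [hu, hv] with h3
    simp only [AffVertex.Incomp, not_and_or, not_not] at h3
    rcases h3 with h3 | h3
    · exact huS (hS u v hvS h3 huT)
    · exact hvT (hT v u huT h3 hvS)

/-- A multichain either avoids `d` or arises uniquely by adjoining one copy of `d`, which is always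
allowed since `d` is comparable to all of `S`. -/
theorem ncard_multichains_succ {S : Set AffVertex} (hS : S.Finite) {d : AffVertex} (hd : d ∈ S)
    (hmax : ∀ v ∈ S, v ≤ d) (n : ℕ) :
    (multichains S (n + 1)).ncard =
      (multichains (S \ {d}) (n + 1)).ncard + (multichains S n).ncard := by
  have hinj : Function.Injective fun m : AffVertex →₀ ℕ => m + Finsupp.single d 1 :=
    add_left_injective _
  have h1 : multichains S (n + 1) =
      multichains (S \ {d}) (n + 1) ∪ (fun m => m + Finsupp.single d 1) '' multichains S n := by
    apply subset_antisymm
    · intro m hm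
      by_cases h : m d = 0
      · refine Or.inl ⟨hm.1, fun v hv => ⟨hm.2.1 v hv, ?_⟩, hm.2.2⟩
        rintro rfl
        exact hv h
      · refine Or.inr ?_
        have hle : Finsupp.single d 1 ≤ m := Finsupp.single_le_iff.2 (by omega)
        obtain ⟨m', rfl⟩ := exists_add_of_le hle
        refine ⟨m', ⟨?_, fun v hv => hm.2.1 v ?_, fun u v huv => ?_⟩, add_comm _ _⟩
        · have := hm.1
          simp at this
          omega
        · simp [hv]
        · have := hm.2.2 u v huv
          simp only [Finsupp.add_apply] at this
          omega
    · refine Set.union_subset (multichains_mono Set.sdiff_subset _) ?_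
      rintro _ ⟨m, hm, rfl⟩
      refine ⟨by simp [hm.1], fun v hv => ?_, fun u v huv => ?_⟩
      · by_cases h : v = d
        · rwa [h]
        · refine hm.2.1 v fun h0 => hv ?_
          simp [h0, Ne.symm h]
      · have key : ∀ u v : AffVertex, u.Incomp v → u = d → m v = 0 := by
          rintro u v huv rfl
          by_contra h
          exact huv.2 (hmax v (hm.2.1 v h))
        by_cases hu : u = d
        · refine Or.inr ?_
          have hv : d ≠ v := by
            rintro rfl
            exact huv.1 hu.le
          simp [key u v huv hu, hv]
        · by_cases hv : v = d
          · simp [key v u huv.symm hv, Ne.symm hu]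
          · simpa [Ne.symm hu, Ne.symm hv] using hm.2.2 u v huv
  have hdisj : Disjoint (multichains (S \ {d}) (n + 1))
      ((fun m => m + Finsupp.single d 1) '' multichains S n) := by
    rw [Set.disjoint_left]
    rintro _ hm ⟨m, -, rfl⟩
    exact (hm.2.1 d (by simp)).2 rfl
  rw [h1, Set.ncard_union_eq hdisj (multichains_finite (hS.subset Set.sdiff_subset) _)
    ((multichains_finite hS n).image _), Set.ncard_image_of_injective _ hinj]

theorem multichainSeries_of_max {S : Set AffVertex} (hS : S.Finite) {d : AffVertex} (hd : d ∈ S)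
    (hmax : ∀ v ∈ S, v ≤ d) :
    (1 - PowerSeries.X) * multichainSeries S = multichainSeries (S \ {d}) := by
  rw [sub_mul, one_mul, sub_eq_iff_eq_add]
  ext n
  cases n with
  | zero => simp [multichainSeries, multichains_zero]
  | succ n =>
    rw [map_add, PowerSeries.coeff_succ_X_mul]
    simp only [multichainSeries, PowerSeries.coeff_mk]
    exact_mod_cast ncard_multichains_succ hS hd hmax n

theorem multichainSeries_union {S T : Set AffVertex} (hfS : S.Finite) (hfT : T.Finite)
    (hS : ∀ u v, v ∈ S → u ≤ v → u ∈ T → u ∈ S) (hT : ∀ u v, v ∈ T → u ≤ v → u ∈ S → u ∈ T) :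
    multichainSeries (S ∪ T) = multichainSeries S + multichainSeries T -
      multichainSeries (S ∩ T) := by
  rw [eq_sub_iff_add_eq]
  ext n
  simp only [map_add, multichainSeries, PowerSeries.coeff_mk]
  rw [← multichains_inter, ← multichains_union n hS hT]
  exact_mod_cast Set.ncard_union_add_ncard_inter _ _ (multichains_finite hfS n)
    (multichains_finite hfT n)

/-! ### The planar recursion for multichain series -/

/-- The vertices above `c` whose coordinates are at most `x` and `y`. -/
def planarInterval (c : AffVertex) (x y : ℤ) : Set AffVertex := {v | c ≤ v ∧ v.x ≤ x ∧ v.y ≤ y}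

theorem AffVertex.exists_of_bounds {x y : ℤ} (h : 2 * ((y + 1) / 2) ≤ x)
    (h' : x ≤ 2 * ((y + 1) / 2) + 3) : ∃ v : AffVertex, v.x = x ∧ v.y = y := by
  have key : ∀ t ∈ Finset.Icc (0 : ℤ) 3, ∀ u ∈ Finset.Icc (0 : ℤ) 7,
      2 * ((t + 1) / 2) ≤ u → u ≤ 2 * ((t + 1) / 2) + 3 →
      ∃ w : SpinorWeight, w.cx = u ∧ w.cy = t := by decide +kernel
  obtain ⟨w, hx, hy⟩ := key (y % 4) (by simp; omega) (x - 4 * (y / 4)) (by simp; omega) (by omega)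
    (by omega)
  exact ⟨⟨w, y / 4⟩, by simp only [AffVertex.x]; omega, by simp only [AffVertex.y]; omega⟩

theorem planarInterval_eq_Icc (c v : AffVertex) : planarInterval c v.x v.y = Set.Icc c v := by
  ext u
  simp [planarInterval, AffVertex.le_iff (a := u)]

theorem planarInterval_finite (c : AffVertex) (x y : ℤ) : (planarInterval c x y).Finite := by
  obtain ⟨w, hx, hy⟩ : ∃ w : AffVertex, x ≤ w.x ∧ y ≤ w.y :=
    -- The vertex (0)^N has both coordinates equal to 4N.
    ⟨⟨.zero, |x| + |y|⟩, by simp only [AffVertex.x, SpinorWeight.cx]; grind,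
      by simp only [AffVertex.y, SpinorWeight.cy]; grind⟩
  refine (Set.toFinite (Set.Icc c w)).subset fun v hv => ⟨hv.1, AffVertex.le_iff.2 ?_⟩
  exact ⟨hv.2.1.trans hx, hv.2.2.trans hy⟩

/-- The multichain series of `planarInterval`. -/
noncomputable def planarSeries (c : AffVertex) (x y : ℤ) : PowerSeries ℂ :=
  multichainSeries (planarInterval c x y)

/-- The bounds say that (x, y) is a vertex, hence the maximum of the region. Removing it leaves the
union of two lower regions, to which inclusion-exclusion applies. -/
theorem planarSeries_step {c : AffVertex} {x y : ℤ} (h : 2 * ((y + 1) / 2) ≤ x)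
    (h' : x ≤ 2 * ((y + 1) / 2) + 3) (hx : c.x ≤ x) (hy : c.y ≤ y) :
    (1 - PowerSeries.X) * planarSeries c x y =
      planarSeries c (x - 1) y + planarSeries c x (y - 1) - planarSeries c (x - 1) (y - 1) := by
  obtain ⟨d, rfl, rfl⟩ := AffVertex.exists_of_bounds h h'
  have hcd : c ≤ d := AffVertex.le_iff.2 ⟨hx, hy⟩
  have h1 : planarInterval c d.x d.y \ {d} =
      planarInterval c (d.x - 1) d.y ∪ planarInterval c d.x (d.y - 1) := by
    ext v
    have : v = d ↔ v.x = d.x ∧ v.y = d.y :=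
      ⟨fun h => h ▸ ⟨rfl, rfl⟩, fun h => AffVertex.ext_coords h.1 h.2⟩
    simp only [planarInterval, Set.mem_sdiff, Set.mem_union, Set.mem_ofPred_eq,
      Set.mem_singleton_iff, this]
    by_cases hv : c ≤ v
    · simp only [hv, true_and]
      omega
    · simp only [hv, false_and, or_self]
  have h2 : planarInterval c (d.x - 1) (d.y - 1) =
      planarInterval c (d.x - 1) d.y ∩ planarInterval c d.x (d.y - 1) := by
    ext v
    simp only [planarInterval, Set.mem_inter_iff, Set.mem_ofPred_eq]
    by_cases hv : c ≤ v
    · simp only [hv, true_and]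
      omega
    · simp only [hv, false_and]
  rw [planarSeries, multichainSeries_of_max (planarInterval_finite _ _ _) (d := d)
    ⟨hcd, le_rfl, le_rfl⟩ fun v hv => AffVertex.le_iff.2 hv.2, h1, planarSeries, planarSeries,
    planarSeries, h2]
  refine multichainSeries_union (planarInterval_finite _ _ _) (planarInterval_finite _ _ _) ?_ ?_
  · rintro u v ⟨h3, h4, h5⟩ huv ⟨h6, h7, h8⟩
    rw [AffVertex.le_iff] at huv
    exact ⟨h6, by omega, by omega⟩
  · rintro u v ⟨h3, h4, h5⟩ huv ⟨h6, h7, h8⟩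
    rw [AffVertex.le_iff] at huv
    exact ⟨h6, by omega, by omega⟩

/-- There are no vertices of second coordinate `y` to the left of the diagram. -/
theorem planarSeries_left (c : AffVertex) {x y : ℤ} (h : x < 2 * ((y + 1) / 2)) :
    planarSeries c x y = planarSeries c x (y - 1) := by
  rw [planarSeries, planarSeries]
  congr 1
  ext v
  have := v.x_bounds
  simp only [planarInterval, Set.mem_ofPred_eq]
  by_cases hv : c ≤ v
  · simp only [hv, true_and]
    omega
  · simp only [hv, false_and]

/-- There are no vertices of first coordinate `x` above the diagram. -/
theorem planarSeries_right (c : AffVertex) {x y : ℤ} (h : 2 * ((y + 1) / 2) + 3 < x) :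
    planarSeries c x y = planarSeries c (x - 1) y := by
  rw [planarSeries, planarSeries]
  congr 1
  ext v
  have := v.x_bounds
  simp only [planarInterval, Set.mem_ofPred_eq]
  by_cases hv : c ≤ v
  · simp only [hv, true_and]
    omega
  · simp only [hv, false_and]

theorem planarSeries_eq_one {c : AffVertex} {x y : ℤ} (h : x < c.x ∨ y < c.y) :
    planarSeries c x y = 1 := by
  rw [planarSeries, ← multichainSeries_empty]
  congr 1
  refine Set.eq_empty_iff_forall_notMem.2 fun v hv => ?_
  have := AffVertex.le_iff.1 hv.1
  have := hv.2
  omega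

/-- At the left end of a row no vertex of that row lies further left, so two terms of
`planarSeries_step` cancel. -/
theorem planarSeries_step_of_left {c : AffVertex} {x y : ℤ} (h : x = 2 * ((y + 1) / 2))
    (hx : c.x ≤ x) (hy : c.y ≤ y) :
    (1 - PowerSeries.X) * planarSeries c x y = planarSeries c x (y - 1) := by
  rw [planarSeries_step (by omega) (by omega) hx hy,
    planarSeries_left c (x := x - 1) (y := y) (by omega)]
  ring

/-- Here column `x` has no vertex in the rows below `y`, so again two terms cancel. -/
theorem planarSeries_step_of_right {c : AffVertex} {x y : ℤ} (h : 2 * (y / 2) + 3 < x)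
    (h' : x ≤ 2 * ((y + 1) / 2) + 3) (hx : c.x ≤ x) (hy : c.y ≤ y) :
    (1 - PowerSeries.X) * planarSeries c x y = planarSeries c (x - 1) y := by
  rw [planarSeries_step (by omega) (by omega) hx hy,
    planarSeries_right c (x := x) (y := y - 1) (by omega)]
  ring

/-! ### The recurrence along the corners of the strip -/

theorem deltaSeries_even (c : AffVertex) (i : ℤ) :
    deltaSeries c (2 * i) = planarSeries c (2 * i + 2) (2 * i + 2) := by
  rw [deltaSeries_eq_multichainSeries, ← planarInterval_eq_Icc, planarSeries]
  congr 2 <;> unfold deltaSeq <;> split_ifs <;>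
    simp only [AffVertex.x, AffVertex.y, SpinorWeight.cx, SpinorWeight.cy] <;> omega

theorem deltaSeries_odd (c : AffVertex) (i : ℤ) :
    deltaSeries c (2 * i + 1) = planarSeries c (2 * i + 5) (2 * i + 1) := by
  rw [deltaSeries_eq_multichainSeries, ← planarInterval_eq_Icc, planarSeries]
  congr 2 <;> unfold deltaSeq <;> split_ifs <;>
    simp only [AffVertex.x, AffVertex.y, SpinorWeight.cx, SpinorWeight.cy] <;> omega

theorem le_deltaSeq_even {c : AffVertex} {i : ℤ} (h : c ≤ deltaSeq (2 * i)) :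
    c.x ≤ 2 * i + 2 ∧ c.y ≤ 2 * i + 2 := by
  rw [AffVertex.le_iff] at h
  unfold deltaSeq at h
  split_ifs at h <;>
    simp only [AffVertex.x, AffVertex.y, SpinorWeight.cx, SpinorWeight.cy] at h ⊢ <;> omega

theorem le_deltaSeq_odd {c : AffVertex} {i : ℤ} (h : c ≤ deltaSeq (2 * i + 1)) :
    c.x ≤ 2 * i + 5 ∧ c.y ≤ 2 * i + 1 := by
  rw [AffVertex.le_iff] at h
  unfold deltaSeq at h
  split_ifs at h <;>
    simp only [AffVertex.x, AffVertex.y, SpinorWeight.cx, SpinorWeight.cy] at h ⊢ <;> omega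

theorem one_sub_X_pow_mul_inv (n : ℕ) :
    (1 - PowerSeries.X : PowerSeries ℂ) ^ n * ((1 - PowerSeries.X) ^ n)⁻¹ = 1 :=
  PowerSeries.mul_inv_cancel _ (by simp)

theorem recursion_of_pow_mul {F G H : PowerSeries ℂ}
    (h : (1 - PowerSeries.X) ^ 4 * F =
      (1 + PowerSeries.X) * (1 - PowerSeries.X) ^ 2 * G + PowerSeries.X * H) :
    F = (1 + PowerSeries.X) * ((1 - PowerSeries.X) ^ 2)⁻¹ * G +
      PowerSeries.X * ((1 - PowerSeries.X) ^ 4)⁻¹ * H := by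
  have h2 := one_sub_X_pow_mul_inv 2
  have h4 := one_sub_X_pow_mul_inv 4
  have hne : (1 - PowerSeries.X : PowerSeries ℂ) ^ 4 ≠ 0 := left_ne_zero_of_mul (h4 ▸ one_ne_zero)
  refine mul_left_cancel₀ hne (h.trans ?_)
  linear_combination (-(1 + PowerSeries.X) * (1 - PowerSeries.X) ^ 2 * G) * h2 -
    PowerSeries.X * H * h4

theorem eq_mul_inv_of_pow_mul {F G : PowerSeries ℂ} {n : ℕ}
    (h : (1 - PowerSeries.X) ^ n * F = G) : F = G * ((1 - PowerSeries.X) ^ n)⁻¹ := by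
  rw [← h, mul_right_comm, one_sub_X_pow_mul_inv, one_mul]

/-- Elimination from the corner (p+4, p+4) down the left boundary. The bounds on `c` are exactly
what places every corner that is removed above `c`. -/
theorem planarSeries_recursion_even {c : AffVertex} {p : ℤ} (hp : Even p) (hx : c.x ≤ p + 2)
    (hy : c.y ≤ p + 1) :
    (1 - PowerSeries.X) ^ 4 * planarSeries c (p + 4) (p + 4) =
      (1 + PowerSeries.X) * (1 - PowerSeries.X) ^ 2 * planarSeries c (p + 5) (p + 1) +
        PowerSeries.X * planarSeries c (p + 2) (p + 2) := by
  obtain ⟨j, rfl⟩ := hp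
  have h44 := planarSeries_step_of_left (c := c) (x := j + j + 4) (y := j + j + 4) (by omega)
    (by omega) (by omega)
  have h43 := planarSeries_step_of_left (c := c) (x := j + j + 4) (y := j + j + 3) (by omega)
    (by omega) (by omega)
  have h42 := planarSeries_step (c := c) (x := j + j + 4) (y := j + j + 2) (by omega) (by omega)
    (by omega) (by omega)
  have h32 := planarSeries_step (c := c) (x := j + j + 3) (y := j + j + 2) (by omega) (by omega)
    (by omega) (by omega)
  have h22 := planarSeries_step_of_left (c := c) (x := j + j + 2) (y := j + j + 2) (by omega)
    (by omega) (by omega)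
  have h41 := planarSeries_step_of_right (c := c) (x := j + j + 4) (y := j + j + 1) (by omega)
    (by omega) (by omega) (by omega)
  have h51 := planarSeries_step_of_right (c := c) (x := j + j + 5) (y := j + j + 1) (by omega)
    (by omega) (by omega) (by omega)
  simp only [add_sub_assoc, Int.reduceSub] at *
  linear_combination (1 - PowerSeries.X) ^ 3 * h44 + (1 - PowerSeries.X) ^ 2 * h43 +
    (1 - PowerSeries.X) * h42 + h32 + h22 - PowerSeries.X * h41 -
    (1 - PowerSeries.X) * (1 + PowerSeries.X) * h51

/-- The same elimination from the right corner (p+7, p+3), moving left along its row first. -/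
theorem planarSeries_recursion_odd {c : AffVertex} {p : ℤ} (hp : Even p) (hx : c.x ≤ p + 4)
    (hy : c.y ≤ p + 1) :
    (1 - PowerSeries.X) ^ 4 * planarSeries c (p + 7) (p + 3) =
      (1 + PowerSeries.X) * (1 - PowerSeries.X) ^ 2 * planarSeries c (p + 4) (p + 4) +
        PowerSeries.X * planarSeries c (p + 5) (p + 1) := by
  obtain ⟨j, rfl⟩ := hp
  have h73 := planarSeries_step_of_right (c := c) (x := j + j + 7) (y := j + j + 3) (by omega)
    (by omega) (by omega) (by omega)
  have h63 := planarSeries_step_of_right (c := c) (x := j + j + 6) (y := j + j + 3) (by omega)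
    (by omega) (by omega) (by omega)
  have h53 := planarSeries_step (c := c) (x := j + j + 5) (y := j + j + 3) (by omega) (by omega)
    (by omega) (by omega)
  have h52 := planarSeries_step (c := c) (x := j + j + 5) (y := j + j + 2) (by omega) (by omega)
    (by omega) (by omega)
  have h51 := planarSeries_step_of_right (c := c) (x := j + j + 5) (y := j + j + 1) (by omega)
    (by omega) (by omega) (by omega)
  have h44 := planarSeries_step_of_left (c := c) (x := j + j + 4) (y := j + j + 4) (by omega)
    (by omega) (by omega)
  have h43 := planarSeries_step_of_left (c := c) (x := j + j + 4) (y := j + j + 3) (by omega)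
    (by omega) (by omega)
  simp only [add_sub_assoc, Int.reduceSub] at *
  linear_combination (1 - PowerSeries.X) ^ 3 * h73 + (1 - PowerSeries.X) ^ 2 * h63 +
    (1 - PowerSeries.X) * h53 + h52 + h51 - PowerSeries.X * h43 -
    (1 - PowerSeries.X) * (1 + PowerSeries.X) * h44

theorem mainTheorem8 :
    (∀ (c : AffVertex) (r : ℤ), c ≤ deltaSeq (r - 1) → c ≤ deltaSeq (r - 2) →
      deltaSeries c r =
        (1 + PowerSeries.X) * ((1 - PowerSeries.X) ^ 2)⁻¹ * deltaSeries c (r - 1) +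
          PowerSeries.X * ((1 - PowerSeries.X) ^ 4)⁻¹ * deltaSeries c (r - 2)) ∧
    deltaSeries ⟨.zero, 0⟩ 0 = ((1 - PowerSeries.X) ^ 5)⁻¹ ∧
    deltaSeries ⟨.zero, 0⟩ 1 = (1 + PowerSeries.X) * ((1 - PowerSeries.X) ^ 7)⁻¹ := by
  refine ⟨fun c r h1 h2 => recursion_of_pow_mul ?_, ?_⟩
  · obtain ⟨i, rfl | rfl⟩ : ∃ i, r = 2 * i ∨ r = 2 * i + 1 := ⟨r / 2, by omega⟩
    · rw [show 2 * i - 1 = 2 * (i - 1) + 1 by ring] at h1 ⊢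
      rw [show 2 * i - 2 = 2 * (i - 1) by ring] at h2 ⊢
      -- Both hypotheses are needed: δ_{r-1} bounds the second coordinate of `c`, and δ_{r-2} the
      -- first. For odd `r` the roles are exchanged.
      have h3 := le_deltaSeq_odd h1
      have h4 := le_deltaSeq_even h2
      rw [deltaSeries_even, deltaSeries_odd, deltaSeries_even]
      have := planarSeries_recursion_even (c := c) (p := 2 * (i - 1)) (even_two_mul _) (by omega)
        (by omega)
      rwa [show 2 * (i - 1) + 4 = 2 * i + 2 by ring] at this
    · rw [show 2 * i + 1 - 1 = 2 * i by ring] at h1 ⊢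
      rw [show 2 * i + 1 - 2 = 2 * (i - 1) + 1 by ring] at h2 ⊢
      have h3 := le_deltaSeq_even h1
      have h4 := le_deltaSeq_odd h2
      rw [deltaSeries_odd, deltaSeries_even, deltaSeries_odd]
      have := planarSeries_recursion_odd (c := c) (p := 2 * (i - 1)) (even_two_mul _) (by omega)
        (by omega)
      rwa [show 2 * (i - 1) + 4 = 2 * i + 2 by ring, show 2 * (i - 1) + 7 = 2 * i + 5 by ring,
        show 2 * (i - 1) + 3 = 2 * i + 1 by ring] at this
  · set c : AffVertex := ⟨.zero, 0⟩ with hc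
    have hcx : c.x = 0 := rfl
    have hcy : c.y = 0 := rfl
    have h00 := planarSeries_step_of_left (c := c) (x := 0) (y := 0) (by omega) (by omega)
      (by omega)
    have h10 := planarSeries_step (c := c) (x := 1) (y := 0) (by omega) (by omega) (by omega)
      (by omega)
    have h20 := planarSeries_step (c := c) (x := 2) (y := 0) (by omega) (by omega) (by omega)
      (by omega)
    have h30 := planarSeries_step (c := c) (x := 3) (y := 0) (by omega) (by omega) (by omega)
      (by omega)
    have h21 := planarSeries_step_of_left (c := c) (x := 2) (y := 1) (by omega) (by omega)
      (by omega)
    have h22 := planarSeries_step_of_left (c := c) (x := 2) (y := 2) (by omega) (by omega)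
      (by omega)
    have h31 := planarSeries_step (c := c) (x := 3) (y := 1) (by omega) (by omega) (by omega)
      (by omega)
    have h41 := planarSeries_step_of_right (c := c) (x := 4) (y := 1) (by omega) (by omega)
      (by omega) (by omega)
    have h51 := planarSeries_step_of_right (c := c) (x := 5) (y := 1) (by omega) (by omega)
      (by omega) (by omega)
    -- Row -1 lies below `c`, which starts the recursion with the series of the empty set.
    have hneg : ∀ x, planarSeries c x (-1) = 1 := fun x => planarSeries_eq_one (by omega)
    norm_num only [hneg] at *
    have e0 := deltaSeries_even c 0
    have e1 := deltaSeries_odd c 0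
    norm_num only at e0 e1
    rw [e0, e1]
    refine ⟨(eq_mul_inv_of_pow_mul ?_).trans (one_mul _), eq_mul_inv_of_pow_mul ?_⟩
    -- The interval from (0)^0 to (15)^0 is a chain of five vertices, one factor 1 - t each.
    · linear_combination (1 - PowerSeries.X) ^ 4 * h22 + (1 - PowerSeries.X) ^ 3 * h21 +
        (1 - PowerSeries.X) ^ 2 * h20 + (1 - PowerSeries.X) * h10 + h00
    -- The factor 1 + t arises at (3, 1), where 2 - (1 - t) = 1 + t records the one incomparable
    -- pair (23), (14).
    · linear_combination (1 - PowerSeries.X) ^ 6 * h51 + (1 - PowerSeries.X) ^ 5 * h41 +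
        (1 - PowerSeries.X) ^ 4 * h31 + (1 - PowerSeries.X) ^ 3 * h21 +
        (1 - PowerSeries.X) ^ 3 * h30 +
        (1 + PowerSeries.X) * ((1 - PowerSeries.X) ^ 2 * h20 + (1 - PowerSeries.X) * h10 + h00)
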